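/- **Theorem.** Let $k\ge 1$, let $A_\ell\in\mathbb R^{n_{\ell-1}\times n_\ell}$ for $\ell=1,\dots,k$ with all $n_i\ge 1$, let $\varepsilon>0$ and $\delta\in(0,1)$, and put $R=\|A_1\|_F^2\cdots\|A_k\|_F^2/\varepsilon^2$. A tug-of-war sketch with $c$ rows is a random matrix $S\in\mathbb R^{c\times q}$ whose entries are independent and uniform in $\{\pm 1/\sqrt c\}$. (1) If $c\ge 1$ is an integer with $c\ge 3^kR/\delta$, and $S_\ell\in\mathbb R^{c\times n_\ell}$ ($1\le \ell\le k-1$) are independent tug-of-war sketches, then $$\Pr\Big[\big\|A_1S_1^TS_1A_2S_2^TS_2\cdots S_{k-1}^TS_{k-1}A_k-A_1\cdots A_k\big\|_F\le\varepsilon\Big]\ge 1-\delta .$$ (2) Time is counted in randomised algebraic computation trees over $\mathbb R$: each instruction sets a register to a real constant, performs one operation $+,-,\times,\div$ on two registers, tosses one fair coin, or branches on one comparison of two registers; each costs one unit of time, registers are fixed in the tree (no addressable memory), registers other than the inputs start at $0$, and the worst case over the coin tosses counts. Let $\omega\ge 2$ be any number such that two $N\times N$ real matrices can be multiplied exactly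 (whatever the coin tosses) in time $O(N^\omega)$ in this model. Then there are constants $C$ and $p$, which depend only on $\omega$, such that for all $k$, $n_0,\dots,n_k$, $\varepsilon$, $\delta$ there are a preprocessing program and a main program, which continues with the registers that the preprocessing leaves behind, such that for all $A_1,\dots,A_k$: * the preprocessing takes time at most $C\,s\,(1+\log s)^p$, where $s=\sum_{\ell=1}^k n_{\ell-1}n_\ell$ is the size of the input; * the main program takes time at most $C\,g\,(1+\log g)^p$, where $$g=3^{k(\omega-2)}\cdot\max_{0\le i\ne j\le k}n_in_j\cdot\max\{1,R\}^{\omega-2}\cdot\max\{1,\log(1/\delta)\},$$ that is, $\widetilde O\big(3^{k(\omega-2)}\max_{i\ne j}n_in_j\,(\|A_1\|_F^2\cdots\|A_k\|_F^2/\varepsilon^2)^{\omega-2}\log(1/\delta)\big)$; * with probability at least $1-\delta$ the matrix $C'$ that is returned satisfies $\|C'-A_1\cdots A_k\|_F\le\varepsilon$. -/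

import Mathlib

/-! ### Matrices -/

open scoped Matrix

open scoped Matrix.Norms.Frobenius in
/-- The Frobenius norm of a real matrix. -/
noncomputable def frobNorm {a b : ℕ} (M : Matrix (Fin a) (Fin b) ℝ) : ℝ := ‖M‖

theorem frobNorm_eq_sqrt {a b : ℕ} (M : Matrix (Fin a) (Fin b) ℝ) :
    frobNorm M = Real.sqrt (∑ i, ∑ j, M i j ^ 2) := by
  simp [frobNorm, Matrix.frobenius_norm_def, Real.sqrt_eq_rpow]

/-- The product `A 0 * A 1 * ⋯ * A (k - 1)` of the first `k` matrices of a chain, where `A ℓ` has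
`n ℓ` rows and `n (ℓ + 1)` columns. -/
noncomputable def chainProd {n : ℕ → ℕ}
    (A : (l : ℕ) → Matrix (Fin (n l)) (Fin (n (l + 1))) ℝ) :
    (k : ℕ) → Matrix (Fin (n 0)) (Fin (n k)) ℝ
  | 0 => 1
  | k + 1 => chainProd A k * A k

/-- The tug-of-war sketch matrix with `c` rows and sign pattern `h`: its entries are
`± 1 / √c`. -/
noncomputable def tugOfWar {c q : ℕ} (h : Fin c → Fin q → Bool) : Matrix (Fin c) (Fin q) ℝ :=
  Matrix.of fun i j => (if h i j then 1 else -1) / Real.sqrt c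

/-- The sketched product `A 0 * (S 0)ᵀ * S 0 * A 1 * (S 1)ᵀ * S 1 * ⋯ * (S (m - 1))ᵀ * S (m - 1) * A m`
of the `m + 1` matrices `A 0, …, A m`, with one sketch matrix at each of the `m` junctions. -/
noncomputable def sketchedProd {n : ℕ → ℕ} {c : ℕ}
    (A : (l : ℕ) → Matrix (Fin (n l)) (Fin (n (l + 1))) ℝ) :
    (m : ℕ) → ((l : Fin m) → Matrix (Fin c) (Fin (n (l + 1))) ℝ) →
      Matrix (Fin (n 0)) (Fin (n (m + 1))) ℝ
  | 0, _ => A 0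
  | m + 1, S =>
      let T : Matrix (Fin c) (Fin (n (m + 1))) ℝ := S (Fin.last m)
      sketchedProd A m (fun l => S l.castSucc) * Tᵀ * T * A (m + 1)

/-- The number of input entries of the chain `A 0, …, A m`. -/
def inputSize (n : ℕ → ℕ) (m : ℕ) : ℕ := ∑ l ∈ Finset.range (m + 1), n l * n (l + 1)

/-- The maximum of `n i * n j` over all `i ≠ j` in `{0, …, m + 1}`. -/
def maxPair (n : ℕ → ℕ) (m : ℕ) : ℕ :=
  (Finset.range (m + 2)).offDiag.sup fun p => n p.1 * n p.2

/-! ### Computation with real numbers -/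

/-- The four arithmetic operations. -/
inductive ArithOp
  | add
  | sub
  | mul
  | div

noncomputable def ArithOp.eval : ArithOp → ℝ → ℝ → ℝ
  | .add, a, b => a + b
  | .sub, a, b => a - b
  | .mul, a, b => a * b
  | .div, a, b => a / b

/-- Randomised algebraic computation trees over a set `ρ` of registers, each holding one real
number. There is no addressable memory: every register that an instruction touches is fixed in
the tree. -/
inductive RealProg (ρ : Type) : Type
  /-- terminate -/
  | halt : RealProg ρ
  /-- `x := a` for a constant `a` -/
  | const (x : ρ) (a : ℝ) (next : RealProg ρ) : RealProg ρ
  /-- `x := y ∘ z` for an arithmetic operation `∘` -/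
  | arith (o : ArithOp) (x y z : ρ) (next : RealProg ρ) : RealProg ρ
  /-- `x := 1` or `x := -1`, by a fair and independent coin toss -/
  | coin (x : ρ) (next : RealProg ρ) : RealProg ρ
  /-- continue with `yes` if `y ≤ z`, and with `no` otherwise -/
  | branch (y z : ρ) (yes no : RealProg ρ) : RealProg ρ

namespace RealProg

open Classical in
/-- The content of the registers after `x := v`. -/
noncomputable def write {ρ : Type} (s : ρ → ℝ) (x : ρ) (v : ℝ) : ρ → ℝ :=
  Function.update s x v

/-- The distribution of the final content of the registers, from the initial content `s`. -/
noncomputable def run {ρ : Type} : RealProg ρ → (ρ → ℝ) → PMF (ρ → ℝ)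
  | halt, s => PMF.pure s
  | const x a p, s => run p (write s x a)
  | arith o x y z p, s => run p (write s x (o.eval (s y) (s z)))
  | coin x p, s =>
      (PMF.uniformOfFintype Bool).bind fun b => run p (write s x (if b then 1 else -1))
  | branch y z p q, s => if s y ≤ s z then run p s else run q s

/-- The running time from the initial content `s`: every instruction takes one unit of time, and
the worst outcome of the coin tosses counts. -/
noncomputable def time {ρ : Type} : RealProg ρ → (ρ → ℝ) → ℕ
  | halt, _ => 0
  | const x a p, s => 1 + time p (write s x a)
  | arith o x y z p, s => 1 + time p (write s x (o.eval (s y) (s z)))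
  | coin x p, s => 1 + max (time p (write s x 1)) (time p (write s x (-1)))
  | branch y z p q, s => 1 + if s y ≤ s z then time p s else time q s

end RealProg

/-- Registers: one for each input number, one for each output number, and work registers. -/
inductive Reg (ι κ : Type) : Type
  | inp (i : ι) : Reg ι κ
  | out (j : κ) : Reg ι κ
  | tmp (t : ℕ) : Reg ι κ

/-- The initial content of the registers: the input `x`, and zeros elsewhere. -/
def initRegs {ι κ : Type} (x : ι → ℝ) : Reg ι κ → ℝ
  | .inp i => x i
  | .out _ => 0
  | .tmp _ => 0

/-- The output matrix that is found in the registers. -/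
def outMatrix {ι : Type} {a b : ℕ} (s : Reg ι (Fin a × Fin b) → ℝ) :
    Matrix (Fin a) (Fin b) ℝ :=
  Matrix.of fun i j => s (.out (i, j))

/-- Two real `N × N` matrices can be multiplied in time `O(N ^ ω)`. -/
def IsMatMulExponent (ω : ℝ) : Prop :=
  ∃ K : ℝ, ∀ N : ℕ, 1 ≤ N →
    ∃ P : RealProg (Reg ((Fin N × Fin N) ⊕ (Fin N × Fin N)) (Fin N × Fin N)),
      ∀ A B : Matrix (Fin N) (Fin N) ℝ,
        (P.time (initRegs (Sum.elim (fun p => A p.1 p.2) (fun p => B p.1 p.2))) : ℝ)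
            ≤ K * (N : ℝ) ^ ω ∧
        ∀ s ∈ (P.run (initRegs (Sum.elim (fun p => A p.1 p.2) (fun p => B p.1 p.2)))).support,
          outMatrix s = A * B

/-- Positions of the entries of the input matrices `A 0, …, A m`. -/
abbrev ChainPos (n : ℕ → ℕ) (m : ℕ) : Type :=
  (l : Fin (m + 1)) × (Fin (n l) × Fin (n (l + 1)))

/-- The registers of a program that takes a chain `A 0, …, A m` as its input and that returns
a matrix of the size of the product. -/
abbrev ChainReg (n : ℕ → ℕ) (m : ℕ) : Type :=
  Reg (ChainPos n m) (Fin (n 0) × Fin (n (m + 1)))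

/-- The registers with the input `A 0, …, A m`. -/
def chainInput {n : ℕ → ℕ} (m : ℕ) (A : (l : ℕ) → Matrix (Fin (n l)) (Fin (n (l + 1))) ℝ) :
    ChainReg n m → ℝ :=
  initRegs fun p => A p.1 p.2.1 p.2.2

/-- The ratio `‖A 0‖² ⋯ ‖A m‖² / ε²` of Frobenius norms. -/
noncomputable def normRatio {n : ℕ → ℕ} (m : ℕ)
    (A : (l : ℕ) → Matrix (Fin (n l)) (Fin (n (l + 1))) ℝ) (ε : ℝ) : ℝ :=
  (∏ l ∈ Finset.range (m + 1), frobNorm (A l) ^ 2) / ε ^ 2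

/-- The quantity `3 ^ (k (ω - 2)) · max_{i ≠ j} n_i n_j · r ^ (ω - 2) · log (1 / δ)` for `k = m + 1`
matrices, with the convention that `r` and `log (1 / δ)` are read as `1` when they are smaller. -/
noncomputable def mainTime (ω : ℝ) (n : ℕ → ℕ) (m : ℕ) (r δ : ℝ) : ℝ :=
  (3 : ℝ) ^ (((m : ℝ) + 1) * (ω - 2)) * (maxPair n m : ℝ) * (max 1 r) ^ (ω - 2) *
    max 1 (Real.log (1 / δ))

/-- `T ≤ C · g · (1 + log g) ^ p`: the bound behind `T = Õ(g)`, for `g ≥ 1`. -/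
def SoftBound (C : ℝ) (p : ℕ) (T : ℕ) (g : ℝ) : Prop :=
  (T : ℝ) ≤ C * g * (1 + Real.log g) ^ p

/-! Accuracy. For a single sketch, each entry of `X Sᵀ S B` is the mean of `c` independent unbiased
estimates of the entry of `X B`, each of variance at most twice the product of the squared lengths
of the row and the column. Hence the expectation of `‖X Sᵀ S B - Z‖²` is at most `(2/c) ‖X‖² ‖B‖² +
‖X B - Z‖²` for every fixed `Z` (`avg_tugOfWar_error`). Since the last sketch is independent of the
earlier ones, this iterates. With `Z = 0`, each junction costs a factor `2/c + 1 ≤ 3` in the second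
moment. With `Z` the exact product, the errors telescope to `(3^m - 1)/c` times the product of the
squared norms, and Markov's inequality finishes (`prob_sketchedProd`).

Confidence. Dividing by `δ` in the number of rows would be too expensive, so the algorithm fixes the
failure probability at `1/64`, repeats `O(log (1/δ))` times (`prob_majority`) and takes the
entrywise median. This loses only a constant in the Frobenius norm (`frobNorm_median_sub_le`): in
every entry a fixed fraction of the good samples errs at least as much as the median.

Time for `ω > 2`. Block multiplication with smallest dimension `d` costs `d^(ω-2)` times the product
of the other two dimensions (`exists_hasMul`). Every product in the sketched chain has `c` as one
dimension, so it costs at most `max n_i n_j · c^(ω-2)` up to a constant. As `R` depends on the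
input, the program computes it and tries `c = 1, 2, 4, …`; if `c` would exceed the smallest
dimension, the exact product is already cheap enough (`good_searchProg`). The remaining factor `k`
is logarithmic in `g`, because `g` contains `3^(k(ω-2))`.

Time for `ω = 2`. That absorption fails, since `g` no longer grows with `k`. But now exact
multiplication is cheap: the preprocessing multiplies the chain down to two factors that meet at the
smallest dimension, in time `O(s)`, and the main program multiplies the two
(`HasMul.exists_exact_programs`).

Programs are written in continuation-passing style, and each result goes to a fresh block of
registers. `Spec` quantifies over all continuations, so time bounds add up and a success probability
that is established at the end of a program passes back unchanged. -/

/-! ### Averages over finite types -/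

/-- The average of a real function on a finite type. -/
noncomputable def avg {Ω : Type*} [Fintype Ω] (f : Ω → ℝ) : ℝ := (∑ x, f x) / Fintype.card Ω

section Avg

variable {Ω Ω' : Type*} [Fintype Ω] [Fintype Ω']

theorem avg_add (f g : Ω → ℝ) : avg (fun x => f x + g x) = avg f + avg g := by
  simp [avg, Finset.sum_add_distrib, add_div]

theorem avg_sub (f g : Ω → ℝ) : avg (fun x => f x - g x) = avg f - avg g := by
  simp [avg, Finset.sum_sub_distrib, sub_div]

theorem avg_mul_left (a : ℝ) (f : Ω → ℝ) : avg (fun x => a * f x) = a * avg f := by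
  simp [avg, ← Finset.mul_sum, mul_div_assoc]

theorem avg_mul_right (a : ℝ) (f : Ω → ℝ) : avg (fun x => f x * a) = avg f * a := by
  simp_rw [mul_comm _ a]; exact avg_mul_left a f

theorem avg_const [Nonempty Ω] (a : ℝ) : avg (fun _ : Ω => a) = a := by
  simp [avg]

theorem avg_sum {ι : Type*} (s : Finset ι) (f : ι → Ω → ℝ) :
    avg (fun x => ∑ i ∈ s, f i x) = ∑ i ∈ s, avg (f i) := by
  simp only [avg, ← Finset.sum_div]
  rw [Finset.sum_comm]

theorem avg_mono {f g : Ω → ℝ} (h : ∀ x, f x ≤ g x) : avg f ≤ avg g :=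
  div_le_div_of_nonneg_right (Finset.sum_le_sum fun x _ => h x) (Nat.cast_nonneg _)

theorem avg_nonneg {f : Ω → ℝ} (h : ∀ x, 0 ≤ f x) : 0 ≤ avg f :=
  div_nonneg (Finset.sum_nonneg fun x _ => h x) (Nat.cast_nonneg _)

theorem avg_equiv (e : Ω ≃ Ω') (f : Ω' → ℝ) : avg (fun x => f (e x)) = avg f := by
  simp [avg, Fintype.card_congr e, Equiv.sum_comp e f]

theorem avg_prod (f : Ω × Ω' → ℝ) : avg f = avg fun x => avg fun y => f (x, y) := by
  simp only [avg, Fintype.sum_prod_type, Fintype.card_prod, ← Finset.sum_div, Nat.cast_mul]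
  rw [div_div, mul_comm]

theorem avg_cons {N : ℕ} (f : (Fin (N + 1) → Ω) → ℝ) :
    avg f = avg fun x => avg fun y : Fin N → Ω => f (Fin.cons x y) := by
  rw [← avg_equiv (Fin.consEquiv fun _ : Fin (N + 1) => Ω) f, avg_prod]
  rfl

/-- The factors may differ because the sketches have different numbers of columns. The last
coordinate is split off to match the recursion of `sketchedProd`. -/
theorem avg_snoc {N : ℕ} {F : Fin (N + 1) → Type} [∀ i, Fintype (F i)]
    (f : ((i : Fin (N + 1)) → F i) → ℝ) :
    avg f = avg fun y : (i : Fin N) → F i.castSucc =>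
      avg fun x : F (Fin.last N) => f (Fin.snoc y x) := by
  rw [← avg_equiv ((Equiv.prodComm _ _).trans (Fin.snocEquiv F)) f, avg_prod]
  rfl

theorem avg_bool (f : Bool → ℝ) : avg f = (f true + f false) / 2 := by
  simp [avg]

/-- The average of a product of functions of independent coordinates. -/
theorem avg_pi_prod (N : ℕ) (f : Ω → ℝ) :
    avg (fun x : Fin N → Ω => ∏ i, f (x i)) = avg f ^ N := by
  induction N with
  | zero => simp [avg]
  | succ N ih =>
    rw [avg_cons]
    simp only [Fin.prod_univ_succ, Fin.cons_zero, Fin.cons_succ, avg_mul_left, ih, avg_mul_right]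
    ring

end Avg

/-! ### The second moment of a tug-of-war sketch -/

/-- The real number `1` or `-1` with the given sign. -/
noncomputable def sgn (b : Bool) : ℝ := if b then 1 else -1

/-- The inner product of `x` with a sign vector. -/
noncomputable def signSum {q : ℕ} (x : Fin q → ℝ) (σ : Fin q → Bool) : ℝ := ∑ p, x p * sgn (σ p)

theorem signSum_cons {q : ℕ} (x : Fin (q + 1) → ℝ) (b : Bool) (σ : Fin q → Bool) :
    signSum x (Fin.cons b σ) = x 0 * sgn b + signSum (Fin.tail x) σ := by
  simp [signSum, Fin.sum_univ_succ, Fin.tail]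

/-- Unbiasedness of one row of a sketch: averaging over the first sign kills the mixed terms. -/
theorem avg_signSum_mul {q : ℕ} (x b : Fin q → ℝ) :
    avg (fun σ => signSum x σ * signSum b σ) = ∑ p, x p * b p := by
  induction q with
  | zero => simp [avg, signSum]
  | succ q ih =>
    rw [avg_cons, avg_bool, ← avg_add, Fin.sum_univ_succ]
    have h : ∀ σ : Fin q → Bool, signSum x (Fin.cons true σ) * signSum b (Fin.cons true σ) +
        signSum x (Fin.cons false σ) * signSum b (Fin.cons false σ) =
        2 * (x 0 * b 0) + 2 * (signSum (Fin.tail x) σ * signSum (Fin.tail b) σ) := by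
      intro σ; simp only [signSum_cons, sgn]; simp; ring
    simp only [h, avg_add, avg_const, avg_mul_left, ih, Fin.tail]
    ring

/-- Only terms of even degree in the first sign survive its average, which leaves the same moment
for the tail plus second moments. The induction step has the slack `2 (x 0 * b 0) ^ 2`, which is
where equality is lost. -/
theorem avg_signSum_sq_mul_sq {q : ℕ} (x b : Fin q → ℝ) :
    avg (fun σ => signSum x σ ^ 2 * signSum b σ ^ 2) ≤
      (∑ p, x p ^ 2) * (∑ p, b p ^ 2) + 2 * (∑ p, x p * b p) ^ 2 := by
  induction q with
  | zero => simp [avg, signSum]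
  | succ q ih =>
    rw [avg_cons, avg_bool, ← avg_add]
    simp only [Fin.sum_univ_succ]
    have h : ∀ σ : Fin q → Bool,
        signSum x (Fin.cons true σ) ^ 2 * signSum b (Fin.cons true σ) ^ 2 +
        signSum x (Fin.cons false σ) ^ 2 * signSum b (Fin.cons false σ) ^ 2 =
        2 * (signSum (Fin.tail x) σ ^ 2 * signSum (Fin.tail b) σ ^ 2) +
        2 * x 0 ^ 2 * (signSum (Fin.tail b) σ * signSum (Fin.tail b) σ) +
        2 * b 0 ^ 2 * (signSum (Fin.tail x) σ * signSum (Fin.tail x) σ) +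
        8 * x 0 * b 0 * (signSum (Fin.tail x) σ * signSum (Fin.tail b) σ) +
        2 * (x 0 ^ 2 * b 0 ^ 2) := by
      intro σ; simp only [signSum_cons, sgn]; simp; ring
    simp only [h, avg_add, avg_const, avg_mul_left, avg_signSum_mul]
    have := ih (Fin.tail x) (Fin.tail b)
    simp only [Fin.tail, ← pow_two] at this ⊢
    nlinarith [this, sq_nonneg (x 0 * b 0)]

/-- The variance is the fourth-order moment minus the squared mean; Cauchy–Schwarz absorbs the
remaining `(∑ p, x p * b p) ^ 2`. -/
theorem avg_signSum_error_sq {q : ℕ} (x b : Fin q → ℝ) :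
    avg (fun σ => (signSum x σ * signSum b σ - ∑ p, x p * b p) ^ 2) ≤
      2 * ((∑ p, x p ^ 2) * ∑ p, b p ^ 2) := by
  have h : ∀ σ : Fin q → Bool, (signSum x σ * signSum b σ - ∑ p, x p * b p) ^ 2 =
      signSum x σ ^ 2 * signSum b σ ^ 2 - 2 * (∑ p, x p * b p) * (signSum x σ * signSum b σ) +
      (∑ p, x p * b p) ^ 2 := by intro σ; ring
  simp only [h, avg_add, avg_sub, avg_mul_left, avg_const, avg_signSum_mul]
  have h1 := avg_signSum_sq_mul_sq x b
  have h2 := Finset.sum_mul_sq_le_sq_mul_sq Finset.univ x b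
  nlinarith

theorem avg_sum_of_centered {Ω : Type*} [Fintype Ω] [Nonempty Ω] (Z : Ω → ℝ) (hZ : avg Z = 0)
    (c : ℕ) : avg (fun σ : Fin c → Ω => ∑ r, Z (σ r)) = 0 := by
  induction c with
  | zero => simp [avg]
  | succ c ih =>
    rw [avg_cons]
    simp only [Fin.sum_univ_succ, Fin.cons_zero, Fin.cons_succ, avg_add, avg_const, hZ, ih, add_zero]

theorem avg_sq_sum_of_centered {Ω : Type*} [Fintype Ω] [Nonempty Ω] (Z : Ω → ℝ) (hZ : avg Z = 0)
    (c : ℕ) : avg (fun σ : Fin c → Ω => (∑ r, Z (σ r)) ^ 2) = c * avg fun x => Z x ^ 2 := by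
  induction c with
  | zero => simp [avg]
  | succ c ih =>
    rw [avg_cons]
    have h : ∀ x (σ : Fin c → Ω), (∑ r, Z ((Fin.cons x σ : Fin (c + 1) → Ω) r)) ^ 2 =
        Z x ^ 2 + 2 * Z x * (∑ r, Z (σ r)) + (∑ r, Z (σ r)) ^ 2 := by
      intro x σ; simp only [Fin.sum_univ_succ, Fin.cons_zero, Fin.cons_succ]; ring
    simp only [h, avg_add, avg_const, avg_mul_left, ih, avg_sum_of_centered Z hZ]
    simp [avg_const]; ring

/-! ### The Frobenius norm and the mean squared error of one sketch -/

/-- The squared Frobenius norm. -/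
def frobSq {a b : ℕ} (M : Matrix (Fin a) (Fin b) ℝ) : ℝ := ∑ i, ∑ j, M i j ^ 2

theorem frobSq_nonneg {a b : ℕ} (M : Matrix (Fin a) (Fin b) ℝ) : 0 ≤ frobSq M :=
  Finset.sum_nonneg fun _ _ => Finset.sum_nonneg fun _ _ => sq_nonneg _

theorem frobNorm_sq {a b : ℕ} (M : Matrix (Fin a) (Fin b) ℝ) : frobNorm M ^ 2 = frobSq M := by
  rw [frobNorm_eq_sqrt]; exact Real.sq_sqrt (frobSq_nonneg M)

theorem frobNorm_nonneg {a b : ℕ} (M : Matrix (Fin a) (Fin b) ℝ) : 0 ≤ frobNorm M := by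
  rw [frobNorm_eq_sqrt]; positivity

theorem frobNorm_le_iff {a b : ℕ} (M : Matrix (Fin a) (Fin b) ℝ) {ε : ℝ} (hε : 0 ≤ ε) :
    frobNorm M ≤ ε ↔ frobSq M ≤ ε ^ 2 := by
  rw [← frobNorm_sq, sq_le_sq₀ (frobNorm_nonneg M) hε]

theorem frobSq_mul_le {a b c : ℕ} (M : Matrix (Fin a) (Fin b) ℝ) (N : Matrix (Fin b) (Fin c) ℝ) :
    frobSq (M * N) ≤ frobSq M * frobSq N := by
  rw [← frobNorm_sq, ← frobNorm_sq, ← frobNorm_sq, ← mul_pow]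
  exact pow_le_pow_left₀ (frobNorm_nonneg _) (Matrix.frobenius_norm_mul M N) 2

theorem mul_tugOfWar_mul_apply {a q b c : ℕ} (X : Matrix (Fin a) (Fin q) ℝ)
    (B : Matrix (Fin q) (Fin b) ℝ) (h : Fin c → Fin q → Bool) (i : Fin a) (j : Fin b) :
    (X * (tugOfWar h)ᵀ * tugOfWar h * B) i j =
      (∑ r, signSum (X i) (h r) * signSum (fun p => B p j) (h r)) / c := by
  rw [Matrix.mul_assoc, Matrix.mul_apply, Finset.sum_div]
  refine Finset.sum_congr rfl fun r _ => ?_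
  have hc : Real.sqrt c * Real.sqrt c = c := Real.mul_self_sqrt (Nat.cast_nonneg c)
  have h1 : (X * (tugOfWar h)ᵀ) i r = signSum (X i) (h r) / Real.sqrt c := by
    simp only [Matrix.mul_apply, tugOfWar, signSum, sgn, Finset.sum_div, Matrix.of_apply,
      Matrix.transpose_apply]
    exact Finset.sum_congr rfl fun p _ => by ring
  have h2 : (tugOfWar h * B) r j = signSum (fun p => B p j) (h r) / Real.sqrt c := by
    simp only [Matrix.mul_apply, tugOfWar, signSum, sgn, Finset.sum_div, Matrix.of_apply]
    exact Finset.sum_congr rfl fun p _ => by ring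
  rw [h1, h2, div_mul_div_comm, hc]

/-- Bias–variance decomposition, entry by entry: the rows of the sketch are independent and
unbiased, so the cross term with the fixed offset `X * B - Z` averages to zero and the variance
gains a factor `1 / c`. The free `Z` serves both the second moment (`Z = 0`) and the error (`Z` the
exact product). -/
theorem avg_tugOfWar_error {a q b c : ℕ} (hc : 1 ≤ c) (X : Matrix (Fin a) (Fin q) ℝ)
    (B : Matrix (Fin q) (Fin b) ℝ) (Z : Matrix (Fin a) (Fin b) ℝ) :
    avg (fun h : Fin c → Fin q → Bool =>
        frobSq (X * (tugOfWar h)ᵀ * tugOfWar h * B - Z)) ≤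
      2 / c * (frobSq X * frobSq B) + frobSq (X * B - Z) := by
  have hc0 : (c : ℝ) ≠ 0 := by positivity
  have key : ∀ i j, avg (fun h : Fin c → Fin q → Bool =>
      ((X * (tugOfWar h)ᵀ * tugOfWar h * B - Z) i j) ^ 2) ≤
      2 / c * ((∑ p, X i p ^ 2) * ∑ p, B p j ^ 2) + ((X * B - Z) i j) ^ 2 := by
    intro i j
    set W : (Fin q → Bool) → ℝ := fun σ =>
      signSum (X i) σ * signSum (fun p => B p j) σ - ∑ p, X i p * B p j with hW
    have hW0 : avg W = 0 := by simp [hW, avg_sub, avg_signSum_mul, avg_const]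
    have hsum : ∀ h : Fin c → Fin q → Bool, ((X * (tugOfWar h)ᵀ * tugOfWar h * B - Z) i j) ^ 2 =
        1 / (c : ℝ) ^ 2 * (∑ r, W (h r)) ^ 2 +
        2 / c * (X * B - Z) i j * (∑ r, W (h r)) + ((X * B - Z) i j) ^ 2 := by
      intro h
      rw [Matrix.sub_apply, mul_tugOfWar_mul_apply, Matrix.sub_apply]
      simp only [hW, Finset.sum_sub_distrib, Finset.sum_const, Finset.card_univ, Fintype.card_fin,
        nsmul_eq_mul, Matrix.mul_apply]
      field_simp
      ring
    simp only [hsum, avg_add, avg_mul_left, avg_const, avg_sum_of_centered W hW0,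
      avg_sq_sum_of_centered W hW0]
    have h1 := avg_signSum_error_sq (X i) (fun p => B p j)
    have h2 : (1 / (c : ℝ) ^ 2 * (c * avg fun x => W x ^ 2)) = 1 / c * avg fun x => W x ^ 2 := by
      field_simp
    rw [h2]
    have h3 : 1 / (c : ℝ) * (avg fun x => W x ^ 2) ≤
      1 / c * (2 * ((∑ p, X i p ^ 2) * ∑ p, B p j ^ 2)) :=
      mul_le_mul_of_nonneg_left h1 (by positivity)
    have h4 : 2 / (c : ℝ) * ((∑ p, X i p ^ 2) * ∑ p, B p j ^ 2) =
      1 / c * (2 * ((∑ p, X i p ^ 2) * ∑ p, B p j ^ 2)) := by ring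
    rw [h4]; linarith
  have h1 : avg (fun h : Fin c → Fin q → Bool =>
        frobSq (X * (tugOfWar h)ᵀ * tugOfWar h * B - Z)) =
      ∑ i, ∑ j, avg (fun h : Fin c → Fin q → Bool =>
        ((X * (tugOfWar h)ᵀ * tugOfWar h * B - Z) i j) ^ 2) := by
    simp only [frobSq, avg_sum]
  have h2 : frobSq X * frobSq B = ∑ i, ∑ j, (∑ p, X i p ^ 2) * ∑ p, B p j ^ 2 := by
    rw [frobSq, frobSq, Finset.sum_comm (γ := Fin q), Finset.sum_mul_sum]
  rw [h1, h2, frobSq, Finset.mul_sum, ← Finset.sum_add_distrib]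
  refine Finset.sum_le_sum fun i _ => ?_
  rw [Finset.mul_sum, ← Finset.sum_add_distrib]
  exact Finset.sum_le_sum fun j _ => key i j

/-! ### The second moment of the sketched product -/

theorem frobSq_mul_sub_le {a b c : ℕ} (X Y : Matrix (Fin a) (Fin b) ℝ)
    (B : Matrix (Fin b) (Fin c) ℝ) :
    frobSq (X * B - Y * B) ≤ frobSq (X - Y) * frobSq B := by
  rw [← Matrix.sub_mul]; exact frobSq_mul_le _ _

theorem avg_frobSq_sketchedProd {n : ℕ → ℕ} {c : ℕ} (hc : 1 ≤ c)
    (A : (l : ℕ) → Matrix (Fin (n l)) (Fin (n (l + 1))) ℝ) (m : ℕ) :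
    avg (fun h : (l : Fin m) → Fin c → Fin (n (l + 1)) → Bool =>
        frobSq (sketchedProd A m (fun l => tugOfWar (h l)))) ≤
      3 ^ m * ∏ l ∈ Finset.range (m + 1), frobSq (A l) := by
  induction m with
  | zero => simp [avg, sketchedProd]
  | succ m ih =>
    rw [avg_snoc]
    have hc' : 2 / (c : ℝ) ≤ 2 := by
      rw [div_le_iff₀ (by positivity)]
      have : (1 : ℝ) ≤ c := by exact_mod_cast hc
      linarith
    calc _ ≤ avg (fun h : (l : Fin m) → Fin c → Fin (n (l + 1)) → Bool =>
        frobSq (sketchedProd A m (fun l => tugOfWar (h l))) * (3 * frobSq (A (m + 1)))) := by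
          refine avg_mono fun h => ?_
          have := avg_tugOfWar_error hc (sketchedProd A m (fun l => tugOfWar (h l)))
            (A (m + 1)) 0
          simp only [sub_zero] at this
          simp only [sketchedProd, Fin.snoc_last, Fin.snoc_castSucc]
          refine this.trans ?_
          have h1 := frobSq_mul_le (sketchedProd A m (fun l => tugOfWar (h l))) (A (m + 1))
          have h2 := mul_nonneg (frobSq_nonneg (sketchedProd A m (fun l => tugOfWar (h l))))
            (frobSq_nonneg (A (m + 1)))
          have h3 := mul_le_mul_of_nonneg_right hc' h2
          linarith
      _ ≤ _ := by
          rw [avg_mul_right, Finset.prod_range_succ _ (m + 1)]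
          have := mul_le_mul_of_nonneg_right ih
            (mul_nonneg (by norm_num : (0 : ℝ) ≤ 3) (frobSq_nonneg (A (m + 1))))
          refine this.trans (le_of_eq ?_)
          ring

/-- One more junction passes on the old error times `frobSq (A (m + 1))` and adds variance governed
by the second moment `3 ^ m`; the numerators satisfy `(3 ^ m - 1) + 2 * 3 ^ m = 3 ^ (m + 1) - 1`. -/
theorem avg_frobSq_sketchedProd_sub {n : ℕ → ℕ} {c : ℕ} (hc : 1 ≤ c)
    (A : (l : ℕ) → Matrix (Fin (n l)) (Fin (n (l + 1))) ℝ) (m : ℕ) :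
    avg (fun h : (l : Fin m) → Fin c → Fin (n (l + 1)) → Bool =>
        frobSq (sketchedProd A m (fun l => tugOfWar (h l)) - chainProd A (m + 1))) ≤
      (3 ^ m - 1) / c * ∏ l ∈ Finset.range (m + 1), frobSq (A l) := by
  induction m with
  | zero => simp [avg, sketchedProd, chainProd, frobSq]
  | succ m ih =>
    rw [avg_snoc]
    calc _ ≤ avg (fun h : (l : Fin m) → Fin c → Fin (n (l + 1)) → Bool =>
        2 / c * frobSq (A (m + 1)) * frobSq (sketchedProd A m (fun l => tugOfWar (h l))) +
        frobSq (A (m + 1)) *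
          frobSq (sketchedProd A m (fun l => tugOfWar (h l)) - chainProd A (m + 1))) := by
          refine avg_mono fun h => ?_
          have := avg_tugOfWar_error hc (sketchedProd A m (fun l => tugOfWar (h l)))
            (A (m + 1)) (chainProd A (m + 2))
          simp only [sketchedProd, Fin.snoc_last, Fin.snoc_castSucc]
          refine this.trans ?_
          have h1 := frobSq_mul_sub_le (sketchedProd A m (fun l => tugOfWar (h l)))
            (chainProd A (m + 1)) (A (m + 1))
          have h2 : chainProd A (m + 2) = chainProd A (m + 1) * A (m + 1) := rfl
          rw [h2]
          linarith
      _ ≤ _ := by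
          rw [avg_add, avg_mul_left, avg_mul_left, Finset.prod_range_succ _ (m + 1)]
          have h0 := frobSq_nonneg (A (m + 1))
          have h1 := mul_le_mul_of_nonneg_left ih h0
          have h2 := mul_le_mul_of_nonneg_left (avg_frobSq_sketchedProd hc A m)
            (mul_nonneg (by positivity : 0 ≤ 2 / (c : ℝ)) h0)
          refine (add_le_add h2 h1).trans (le_of_eq ?_)
          ring

/-! ### Probabilities -/

/-- The proportion of the elements of a finite type that lie in a set. -/
noncomputable def prob {Ω : Type*} [Fintype Ω] (E : Set Ω) : ℝ := avg (E.indicator fun _ => 1)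

theorem toOuterMeasure_uniform {Ω : Type*} [Fintype Ω] [Nonempty Ω] (E : Set Ω) :
    (PMF.uniformOfFintype Ω).toOuterMeasure E = ENNReal.ofReal (prob E) := by
  classical
  rw [PMF.toOuterMeasure_uniformOfFintype_apply, prob, avg,
    ENNReal.ofReal_div_of_pos (by exact_mod_cast Fintype.card_pos)]
  congr 1
  · rw [Finset.sum_indicator_eq_sum_filter]
    simp [Fintype.card_subtype]
  · simp

/-- Markov's inequality: `f` dominates the indicator of the complement of `E`. -/
theorem one_sub_avg_le_prob {Ω : Type*} [Fintype Ω] [Nonempty Ω] (E : Set Ω) (f : Ω → ℝ)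
    (hf : ∀ x, 0 ≤ f x) (h : ∀ x, x ∉ E → 1 ≤ f x) : 1 - avg f ≤ prob E := by
  rw [← avg_const (Ω := Ω) 1, ← avg_sub]
  refine avg_mono fun x => ?_
  by_cases hx : x ∈ E
  · simp [hx, hf x]
  · simp [hx, h x hx]

theorem prob_sketchedProd (m : ℕ) (n : ℕ → ℕ)
    (A : (l : ℕ) → Matrix (Fin (n l)) (Fin (n (l + 1))) ℝ) (c : ℕ) (ε δ : ℝ) (hc : 1 ≤ c)
    (hε : 0 < ε) (hδ : 0 < δ) (hR : 3 ^ (m + 1) * normRatio m A ε / δ ≤ (c : ℝ)) :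
    1 - δ ≤ prob {h : (l : Fin m) → Fin c → Fin (n (l + 1)) → Bool |
      frobNorm (sketchedProd A m (fun l => tugOfWar (h l)) - chainProd A (m + 1)) ≤ ε} := by
  have hc0 : (0 : ℝ) < c := by positivity
  refine le_trans ?_ (one_sub_avg_le_prob _ (fun h => 1 / ε ^ 2 *
    frobSq (sketchedProd A m (fun l => tugOfWar (h l)) - chainProd A (m + 1)))
    (fun h => mul_nonneg (by positivity) (frobSq_nonneg _)) ?_)
  · rw [avg_mul_left]
    have h1 := mul_le_mul_of_nonneg_left (avg_frobSq_sketchedProd_sub hc A m)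
      (by positivity : 0 ≤ 1 / ε ^ 2)
    have h2 : 1 / ε ^ 2 * ((3 ^ m - 1) / c * ∏ l ∈ Finset.range (m + 1), frobSq (A l)) ≤ δ := by
      simp only [normRatio, frobNorm_sq] at hR
      have hP : 0 ≤ ∏ l ∈ Finset.range (m + 1), frobSq (A l) :=
        Finset.prod_nonneg fun l _ => frobSq_nonneg _
      rw [div_le_iff₀ hδ] at hR
      have h3 : 1 / ε ^ 2 * ((3 ^ m - 1) / c * ∏ l ∈ Finset.range (m + 1), frobSq (A l)) =
        ((3 ^ m - 1) * ((∏ l ∈ Finset.range (m + 1), frobSq (A l)) / ε ^ 2)) / c := by ring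
      rw [h3, div_le_iff₀ hc0, mul_comm δ]
      refine le_trans (mul_le_mul_of_nonneg_right ?_ (by positivity)) hR
      have : (0 : ℝ) ≤ 3 ^ m := by positivity
      rw [pow_succ]; linarith
    linarith
  · intro h hh
    simp only [Set.mem_ofPred_eq, frobNorm_le_iff _ hε.le, not_le] at hh
    rw [one_div, ← div_eq_inv_mul, one_le_div (by positivity)]
    exact hh.le

/-- If each of `t` independent samples is good with probability at least `63 / 64`, then more than
two thirds of them are good, except with probability `2 ^ (-t)`. -/
theorem prob_majority {Ω : Type*} [Fintype Ω] [Nonempty Ω] (E : Set Ω) (hE : 1 - 1 / 64 ≤ prob E)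
    (t : ℕ) : 1 - (1 / 2) ^ t ≤ prob {x : Fin t → Ω | 3 * {i | x i ∉ E}.ncard ≤ t} := by
  classical
  -- An exponential weight: its mean is at most `1 / 2`, so the product over `t` samples has mean at
  -- most `(1 / 2) ^ t`. With `b > t / 3` bad and `g ≤ 2 * b` good samples the product is `4 ^ (2 *
  -- b) / 4 ^ g ≥ 1`, and Markov applies.
  set f : Ω → ℝ := fun x => if x ∈ E then 1 / 4 else 16 with hf
  have hf0 : ∀ x, 0 < f x := fun x => by simp only [hf]; split_ifs <;> norm_num
  have havg : avg f ≤ 1 / 2 := by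
    have : f = fun x => 16 - 63 / 4 * E.indicator (fun _ => (1 : ℝ)) x := by
      funext x
      by_cases hx : x ∈ E <;> simp [hf, hx]; norm_num
    rw [this, avg_sub, avg_const, avg_mul_left]
    have h2 : avg (fun x => E.indicator (fun _ => (1 : ℝ)) x) = prob E := rfl
    rw [h2]; linarith
  refine le_trans ?_ (one_sub_avg_le_prob _ (fun x => ∏ i, f (x i))
    (fun x => Finset.prod_nonneg fun i _ => (hf0 _).le) ?_)
  · rw [avg_pi_prod]
    have := pow_le_pow_left₀ (avg_nonneg fun x => (hf0 x).le) havg t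
    linarith
  · intro x hx
    simp only [Set.mem_ofPred_eq, not_le] at hx
    simp only [hf]
    rw [Finset.prod_ite, Finset.prod_const, Finset.prod_const]
    set g := (Finset.univ.filter fun i => x i ∈ E).card
    have hb : {i | x i ∉ E}.ncard = (Finset.univ.filter fun i => ¬ x i ∈ E).card := by
      rw [← Set.ncard_coe_finset]; simp
    rw [hb] at hx
    set b := (Finset.univ.filter fun i => ¬ x i ∈ E).card
    have hgb : g + b = t := by
      have := Finset.card_filter_add_card_filter_not (s := (Finset.univ : Finset (Fin t)))
        (fun i => x i ∈ E)
      simpa using this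
    have hle : g ≤ 2 * b := by omega
    rw [show (16 : ℝ) = 4 ^ 2 by norm_num, ← pow_mul, one_div, inv_pow, ← div_eq_inv_mul,
      one_le_div (by positivity)]
    exact pow_le_pow_right₀ (by norm_num) hle

/-- A coordinate-wise median of `t` matrices, at most a third of which are far from `P`, is
close to `P`. -/
theorem frobNorm_median_sub_le {a b t : ℕ} (X : Fin t → Matrix (Fin a) (Fin b) ℝ)
    (P M : Matrix (Fin a) (Fin b) ℝ) {ε : ℝ} (hε : 0 ≤ ε) (ht : 1 ≤ t)
    (hX : 3 * {r | ¬ frobNorm (X r - P) ≤ ε / 3}.ncard ≤ t)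
    (hlo : ∀ i j, t ≤ 2 * (Finset.univ.filter fun r => X r i j ≤ M i j).card)
    (hhi : ∀ i j, t ≤ 2 * (Finset.univ.filter fun r => M i j ≤ X r i j).card) :
    frobNorm (M - P) ≤ ε := by
  classical
  set G := Finset.univ.filter fun r => frobNorm (X r - P) ≤ ε / 3
  set B := Finset.univ.filter fun r => ¬ frobNorm (X r - P) ≤ ε / 3
  have hB : 3 * B.card ≤ t := by
    have : {r | ¬ frobNorm (X r - P) ≤ ε / 3}.ncard = B.card := by
      rw [← Set.ncard_coe_finset]; simp [B]
    rwa [this] at hX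
  have hpos : (0 : ℝ) < t := by exact_mod_cast ht
  -- On the side of the median away from `P` lie at least half of the samples, all with at least the
  -- error of the median. At most a third of all samples are bad, so at least `t / 2 - t / 3 = t /
  -- 6` of these are good.
  have key : ∀ i j, (t : ℝ) / 6 * (M - P) i j ^ 2 ≤ ∑ r ∈ G, (X r - P) i j ^ 2 := by
    intro i j
    have hF : ∃ F : Finset (Fin t), t ≤ 2 * F.card ∧
        ∀ r ∈ F, (M - P) i j ^ 2 ≤ (X r - P) i j ^ 2 := by
      rcases le_total (P i j) (M i j) with h | h
      · refine ⟨_, hhi i j, fun r hr => ?_⟩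
        have hr := (Finset.mem_filter.1 hr).2
        simp only [Matrix.sub_apply]
        exact pow_le_pow_left₀ (by linarith) (by linarith) 2
      · refine ⟨_, hlo i j, fun r hr => ?_⟩
        have hr := (Finset.mem_filter.1 hr).2
        simp only [Matrix.sub_apply]
        rw [← neg_sq, ← neg_sq (X r i j - P i j)]
        exact pow_le_pow_left₀ (by linarith) (by linarith) 2
    obtain ⟨F, hF1, hF2⟩ := hF
    have hcard : t ≤ 6 * (F.filter fun r => r ∈ G).card := by
      have h1 := Finset.card_filter_add_card_filter_not (s := F) (fun r => r ∈ G)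
      have h2 : (F.filter fun r => ¬ r ∈ G).card ≤ B.card :=
        Finset.card_le_card fun r hr => by
          have := (Finset.mem_filter.1 hr).2
          simpa [G, B] using this
      omega
    calc (t : ℝ) / 6 * (M - P) i j ^ 2
        ≤ (F.filter fun r => r ∈ G).card * (M - P) i j ^ 2 := by
          refine mul_le_mul_of_nonneg_right ?_ (sq_nonneg _)
          rw [div_le_iff₀ (by norm_num)]
          have : (t : ℝ) ≤ ((6 * (F.filter fun r => r ∈ G).card : ℕ) : ℝ) := by
            exact_mod_cast hcard
          push_cast at this; linarith
      _ = ∑ r ∈ F.filter fun r => r ∈ G, (M - P) i j ^ 2 := by simp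
      _ ≤ ∑ r ∈ F.filter fun r => r ∈ G, (X r - P) i j ^ 2 :=
          Finset.sum_le_sum fun r hr => hF2 r (Finset.mem_filter.1 hr).1
      _ ≤ ∑ r ∈ G, (X r - P) i j ^ 2 :=
          Finset.sum_le_sum_of_subset_of_nonneg (fun r hr => (Finset.mem_filter.1 hr).2)
            fun _ _ _ => sq_nonneg _
  have hsum : (t : ℝ) / 6 * frobSq (M - P) ≤ ∑ r ∈ G, frobSq (X r - P) := by
    simp only [frobSq, Finset.mul_sum]
    rw [Finset.sum_comm (s := G)]
    refine Finset.sum_le_sum fun i _ => ?_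
    rw [Finset.sum_comm (s := G)]
    exact Finset.sum_le_sum fun j _ => key i j
  have hG : ∑ r ∈ G, frobSq (X r - P) ≤ t * (ε / 3) ^ 2 := by
    calc ∑ r ∈ G, frobSq (X r - P) ≤ ∑ r ∈ G, (ε / 3) ^ 2 :=
          Finset.sum_le_sum fun r hr =>
            (frobNorm_le_iff _ (by positivity)).1 (Finset.mem_filter.1 hr).2
      _ = G.card * (ε / 3) ^ 2 := by simp
      _ ≤ t * (ε / 3) ^ 2 := by
          refine mul_le_mul_of_nonneg_right ?_ (sq_nonneg _)
          have := Finset.card_le_univ G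
          simp only [Fintype.card_fin] at this
          exact_mod_cast this
  rw [frobNorm_le_iff _ hε]
  have : (t : ℝ) * (frobSq (M - P) / 6) ≤ t * (ε / 3) ^ 2 := by linarith
  have := le_of_mul_le_mul_left this hpos
  -- The bound obtained is `6 * (ε / 3) ^ 2 = (2 / 3) * ε ^ 2`.
  nlinarith [sq_nonneg ε]

/-! ### Sequential composition and renaming of programs -/

namespace RealProg

variable {ρ σ : Type}

/-- Run `p`, and then `k`. -/
def seq : RealProg ρ → RealProg ρ → RealProg ρ
  | halt, k => k
  | const x a p, k => const x a (seq p k)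
  | arith o x y z p, k => arith o x y z (seq p k)
  | coin x p, k => coin x (seq p k)
  | branch y z p q, k => branch y z (seq p k) (seq q k)

theorem run_seq (p k : RealProg ρ) (s : ρ → ℝ) : run (seq p k) s = (run p s).bind (run k) := by
  induction p generalizing s with
  | halt => simp [seq, run]
  | const x a p ih => simp [seq, run, ih]
  | arith o x y z p ih => simp [seq, run, ih]
  | coin x p ih => simp [seq, run, ih, PMF.bind_bind]
  | branch y z p q ihp ihq =>
    simp only [seq, run]
    split_ifs
    · exact ihp s
    · exact ihq s

theorem mem_support_run_coin {x : ρ} {p : RealProg ρ} {s s' : ρ → ℝ} {b : Bool}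
    (h : s' ∈ (run p (write s x (if b then 1 else -1))).support) :
    s' ∈ (run (coin x p) s).support := by
  simp only [run, PMF.mem_support_bind_iff]
  exact ⟨b, by simp, h⟩

/-- The continuation needs a time bound only on memories that `p` can actually reach, which lets
correctness of `p` enter the running time of `k`. -/
theorem time_seq_le (p k : RealProg ρ) (s : ρ → ℝ) (T : ℝ)
    (h : ∀ s' ∈ (run p s).support, (time k s' : ℝ) ≤ T) :
    (time (seq p k) s : ℝ) ≤ time p s + T := by
  induction p generalizing s with
  | halt => simpa [seq, time, run] using h
  | const x a p ih =>
    simp only [seq, time, Nat.cast_add]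
    have := ih _ h
    linarith
  | arith o x y z p ih =>
    simp only [seq, time, Nat.cast_add]
    have := ih _ h
    linarith
  | coin x p ih =>
    simp only [seq, time, Nat.cast_add, Nat.cast_max]
    have h1 := ih (write s x 1) fun s' hs' => h s' (mem_support_run_coin (b := true) (by simpa using hs'))
    have h2 := ih (write s x (-1))
      fun s' hs' => h s' (mem_support_run_coin (b := false) (by simpa using hs'))
    rw [add_assoc]
    refine add_le_add_right (max_le (h1.trans ?_) (h2.trans ?_)) _
    · exact add_le_add_left (le_max_left _ _) _
    · exact add_le_add_left (le_max_right _ _) _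
  | branch y z p q ihp ihq =>
    simp only [seq, time, run] at h ⊢
    split_ifs at h ⊢
    · push_cast; have := ihp s h; linarith
    · push_cast; have := ihq s h; linarith

/-- Rename the registers of a program. -/
def rename (e : ρ → σ) : RealProg ρ → RealProg σ
  | halt => halt
  | const x a p => const (e x) a (rename e p)
  | arith o x y z p => arith o (e x) (e y) (e z) (rename e p)
  | coin x p => coin (e x) (rename e p)
  | branch y z p q => branch (e y) (e z) (rename e p) (rename e q)

theorem write_comp {e : ρ → σ} (he : Function.Injective e) (s : σ → ℝ) (x : ρ) (v : ℝ) :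
    write s (e x) v ∘ e = write (s ∘ e) x v := by
  classical
  funext r
  by_cases h : r = x
  · subst h; simp [write]
  · simp [write, h, he.ne h]

theorem extend_write {e : ρ → σ} (u : ρ → ℝ) (s : σ → ℝ) (x : ρ) (v : ℝ) :
    Function.extend e u (write s (e x) v) = Function.extend e u s := by
  classical
  funext r
  by_cases h : ∃ a, e a = r
  · simp [Function.extend_def, h]
  · rw [Function.extend_apply' _ _ _ h, Function.extend_apply' _ _ _ h]
    refine Function.update_of_ne ?_ _ _
    rintro rfl
    exact h ⟨x, rfl⟩

theorem time_rename {e : ρ → σ} (he : Function.Injective e) (p : RealProg ρ) (s : σ → ℝ) :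
    time (rename e p) s = time p (s ∘ e) := by
  induction p generalizing s with
  | halt => rfl
  | const x a p ih => simp [rename, time, ih, write_comp he]
  | arith o x y z p ih => simp [rename, time, ih, write_comp he]
  | coin x p ih => simp [rename, time, ih, write_comp he]
  | branch y z p q ihp ihq => simp [rename, time, ihp, ihq]

/-- `Function.extend e u s` is the memory `u` on the image of `e` and the untouched `s` elsewhere.
Injectivity keeps distinct registers of the subroutine distinct. -/
theorem run_rename {e : ρ → σ} (he : Function.Injective e) (p : RealProg ρ) (s : σ → ℝ) :
    run (rename e p) s = (run p (s ∘ e)).map fun u => Function.extend e u s := by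
  induction p generalizing s with
  | halt =>
    have : Function.extend e (s ∘ e) s = s := by
      funext r
      by_cases h : ∃ a, e a = r
      · obtain ⟨a, rfl⟩ := h
        rw [he.extend_apply]; rfl
      · rw [Function.extend_apply' _ _ _ h]
    simp [rename, run, PMF.pure_map, this]
  | const x a p ih => simp [rename, run, ih, write_comp he, extend_write]
  | arith o x y z p ih => simp [rename, run, ih, write_comp he, extend_write]
  | coin x p ih => simp [rename, run, ih, write_comp he, extend_write, PMF.map_bind]
  | branch y z p q ihp ihq =>
    simp only [rename, run, Function.comp_apply]
    split_ifs
    · exact ihp s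
    · exact ihq s

/-! ### Time and success probability -/

/-- From the memory `s`, the program takes time at most `T`, and with probability at least `q` it
ends with a memory in `R`. -/
structure Good (p : RealProg ρ) (s : ρ → ℝ) (T : ℝ) (q : ENNReal) (R : Set (ρ → ℝ)) : Prop where
  time_le : (time p s : ℝ) ≤ T
  le_prob : q ≤ (run p s).toOuterMeasure R

theorem Good.mono {p : RealProg ρ} {s : ρ → ℝ} {T T' : ℝ} {q : ENNReal} {R : Set (ρ → ℝ)}
    (h : Good p s T q R) (hT : T ≤ T') : Good p s T' q R :=
  ⟨h.time_le.trans hT, h.le_prob⟩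

theorem Good.const {x : ρ} {a : ℝ} {p : RealProg ρ} {s : ρ → ℝ} {T : ℝ} {q : ENNReal}
    {R : Set (ρ → ℝ)} (h : Good p (write s x a) T q R) : Good (const x a p) s (1 + T) q R :=
  ⟨by simpa [time] using h.time_le, h.le_prob⟩

theorem Good.arith {o : ArithOp} {x y z : ρ} {p : RealProg ρ} {s : ρ → ℝ} {T : ℝ} {q : ENNReal}
    {R : Set (ρ → ℝ)} (h : Good p (write s x (o.eval (s y) (s z))) T q R) :
    Good (arith o x y z p) s (1 + T) q R :=
  ⟨by simpa [time] using h.time_le, h.le_prob⟩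

theorem Good.branch_yes {y z : ρ} {p p' : RealProg ρ} {s : ρ → ℝ} {T : ℝ} {q : ENNReal}
    {R : Set (ρ → ℝ)} (hyz : s y ≤ s z) (h : Good p s T q R) :
    Good (branch y z p p') s (1 + T) q R :=
  ⟨by simpa [time, hyz] using h.time_le, by simpa [run, hyz] using h.le_prob⟩

theorem Good.branch_no {y z : ρ} {p p' : RealProg ρ} {s : ρ → ℝ} {T : ℝ} {q : ENNReal}
    {R : Set (ρ → ℝ)} (hyz : ¬ s y ≤ s z) (h : Good p' s T q R) :
    Good (branch y z p p') s (1 + T) q R :=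
  ⟨by simpa [time, hyz] using h.time_le, by simpa [run, hyz] using h.le_prob⟩

theorem le_toOuterMeasure_bind {α β : Type} (p : PMF α) (f : α → PMF β) (q : ENNReal) (R : Set β)
    (h : ∀ a ∈ p.support, q ≤ (f a).toOuterMeasure R) : q ≤ (p.bind f).toOuterMeasure R := by
  rw [PMF.toOuterMeasure_bind_apply]
  calc q = ∑' a, p a * q := by rw [ENNReal.tsum_mul_right, p.tsum_coe, one_mul]
    _ ≤ _ := by
      refine ENNReal.tsum_le_tsum fun a => ?_
      by_cases ha : p a = 0
      · simp [ha]
      · gcongr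
        exact h a ((PMF.mem_support_iff p a).2 ha)

theorem Good.seq {p k : RealProg ρ} {s : ρ → ℝ} {T T' : ℝ} {q : ENNReal} {R : Set (ρ → ℝ)}
    (hp : (time p s : ℝ) ≤ T) (h : ∀ s' ∈ (run p s).support, Good k s' T' q R) :
    Good (seq p k) s (T + T') q R := by
  refine ⟨(time_seq_le p k s T' fun s' hs' => (h s' hs').time_le).trans (by linarith), ?_⟩
  rw [run_seq]
  exact le_toOuterMeasure_bind _ _ _ _ fun s' hs' => (h s' hs').le_prob

/-! ### Program fragments that copy registers and toss coins -/

/-- Copy the registers `src` to the registers `dst`. -/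
def copy : (N : ℕ) → (Fin N → ρ) → (Fin N → ρ) → RealProg ρ → RealProg ρ
  | 0, _, _, k => k
  | N + 1, dst, src, k =>
      const (dst 0) 0 (arith .add (dst 0) (dst 0) (src 0) (copy N (Fin.tail dst) (Fin.tail src) k))

/-- Two instructions per register, since a move is simulated by `x := 0` and `x := x + y`. No source
may be a target, or it would be overwritten. -/
theorem exists_copy (N : ℕ) (dst src : Fin N → ρ) (hd : Function.Injective dst)
    (hs : ∀ i j, src i ≠ dst j) (s : ρ → ℝ) :
    ∃ s', (∀ i, s' (dst i) = s (src i)) ∧ (∀ r, (∀ i, r ≠ dst i) → s' r = s r) ∧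
      ∀ k T q R, Good k s' T q R → Good (copy N dst src k) s (2 * N + T) q R := by
  classical
  induction N generalizing s with
  | zero => exact ⟨s, fun i => i.elim0, fun r _ => rfl, fun k T q R h => by simpa [copy] using h⟩
  | succ N ih =>
    set s₁ := write (write s (dst 0) 0) (dst 0)
      (ArithOp.add.eval (write s (dst 0) 0 (dst 0)) (write s (dst 0) 0 (src 0))) with hs₁
    have h0 : s₁ (dst 0) = s (src 0) := by
      simp [hs₁, write, ArithOp.eval, hs]
    have h1 : ∀ r, r ≠ dst 0 → s₁ r = s r := by
      intro r hr; simp [hs₁, write, hr]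
    obtain ⟨s', e1, e2, e3⟩ := ih (Fin.tail dst) (Fin.tail src)
      (fun i j h => Fin.succ_injective _ (hd h)) (fun i j => hs _ _) s₁
    refine ⟨s', ?_, ?_, ?_⟩
    · intro i
      refine Fin.cases ?_ (fun i => ?_) i
      · rw [e2 _ fun i h => (Fin.succ_ne_zero i) (hd h).symm, h0]
      · exact (e1 i).trans (h1 _ (hs _ _))
    · intro r hr
      rw [e2 r fun i => hr _, h1 r (hr 0)]
    · intro k T q R h
      have := (e3 k T q R h).arith.const
      refine this.mono (le_of_eq ?_)
      push_cast; ring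

/-- Toss a coin into each of the registers `dst`. -/
def toss : (N : ℕ) → (Fin N → ρ) → RealProg ρ → RealProg ρ
  | 0, _, k => k
  | N + 1, dst, k => coin (dst 0) (toss N (Fin.tail dst) k)

/-- The memory after the coins `b` have been tossed. -/
noncomputable def tossed : (N : ℕ) → (Fin N → ρ) → (ρ → ℝ) → (Fin N → Bool) → ρ → ℝ
  | 0, _, s, _ => s
  | N + 1, dst, s, b => tossed N (Fin.tail dst) (write s (dst 0) (sgn (b 0))) (Fin.tail b)

theorem tossed_of_ne (N : ℕ) (dst : Fin N → ρ) (s : ρ → ℝ) (b : Fin N → Bool) (r : ρ)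
    (hr : ∀ i, r ≠ dst i) : tossed N dst s b r = s r := by
  classical
  induction N generalizing s with
  | zero => rfl
  | succ N ih =>
    rw [tossed, ih (Fin.tail dst) _ _ fun i => hr _]
    exact Function.update_of_ne (hr 0) _ _

theorem tossed_apply (N : ℕ) (dst : Fin N → ρ) (hd : Function.Injective dst) (s : ρ → ℝ)
    (b : Fin N → Bool) (i : Fin N) : tossed N dst s b (dst i) = sgn (b i) := by
  classical
  induction N generalizing s with
  | zero => exact i.elim0
  | succ N ih =>
    rw [tossed]
    refine Fin.cases ?_ (fun i => ?_) i
    · rw [tossed_of_ne _ (Fin.tail dst) _ _ _ fun i h => (Fin.succ_ne_zero i) (hd h).symm]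
      exact Function.update_self _ _ _
    · exact ih (Fin.tail dst) (fun i j h => Fin.succ_injective _ (hd h)) _ _ i

theorem time_toss_le (N : ℕ) (dst : Fin N → ρ) (k : RealProg ρ) (s : ρ → ℝ) (T : ℝ)
    (h : ∀ b, (time k (tossed N dst s b) : ℝ) ≤ T) : (time (toss N dst k) s : ℝ) ≤ N + T := by
  induction N generalizing s with
  | zero => simpa [toss, tossed] using h Fin.elim0
  | succ N ih =>
    simp only [toss, time, Nat.cast_add, Nat.cast_max, Nat.cast_one]
    have h1 := ih (Fin.tail dst) (write s (dst 0) 1) fun b => by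
      simpa [tossed, sgn] using h (Fin.cons true b)
    have h2 := ih (Fin.tail dst) (write s (dst 0) (-1)) fun b => by
      simpa [tossed, sgn] using h (Fin.cons false b)
    have := max_le h1 h2
    linarith

/-- Each coin halves the probability space just as `avg_cons` and `avg_bool` split `prob E`;
outcomes outside `E` contribute at least zero. -/
theorem prob_le_toss (N : ℕ) (dst : Fin N → ρ) (k : RealProg ρ) (s : ρ → ℝ)
    (E : Set (Fin N → Bool)) (R : Set (ρ → ℝ))
    (h : ∀ b ∈ E, 1 ≤ (run k (tossed N dst s b)).toOuterMeasure R) :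
    ENNReal.ofReal (prob E) ≤ (run (toss N dst k) s).toOuterMeasure R := by
  induction N generalizing s with
  | zero =>
    by_cases hE : Fin.elim0 ∈ E
    · have := h _ hE
      simp only [toss, tossed] at this ⊢
      refine le_trans ?_ this
      rw [ENNReal.ofReal_le_one, ← avg_const (Ω := Fin 0 → Bool) 1]
      exact avg_mono fun x => Set.indicator_le' (fun _ _ => le_rfl) (fun _ _ => zero_le_one) x
    · have : E = ∅ := by
        ext b
        rw [Subsingleton.elim b Fin.elim0]
        simpa using hE
      simp [this, prob, avg]
  | succ N ih =>
    have hE : prob E = (prob {b | Fin.cons true b ∈ E} + prob {b | Fin.cons false b ∈ E}) / 2 := by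
      rw [prob, avg_cons, avg_bool]
      rfl
    have h1 := ih (Fin.tail dst) (write s (dst 0) 1) {b | Fin.cons true b ∈ E} fun b hb => by
      simpa [tossed, sgn] using h _ hb
    have h2 := ih (Fin.tail dst) (write s (dst 0) (-1)) {b | Fin.cons false b ∈ E} fun b hb => by
      simpa [tossed, sgn] using h _ hb
    simp only [toss, run]
    rw [PMF.toOuterMeasure_bind_apply, tsum_bool, hE,
      ENNReal.ofReal_div_of_pos (by norm_num)]
    simp only [PMF.uniformOfFintype_apply, Fintype.card_bool, if_true, Bool.false_eq_true, if_false]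
    refine le_trans (ENNReal.div_le_div_right ENNReal.ofReal_add_le _) ?_
    rw [ENNReal.add_div, add_comm, ENNReal.div_eq_inv_mul, ENNReal.div_eq_inv_mul,
      ENNReal.ofReal_ofNat]
    exact add_le_add (mul_le_mul_right h2 _) (mul_le_mul_right h1 _)

end RealProg

/-! ### Procedures that keep their results in fresh registers -/

/-- Registers that come in an infinite sequence of infinite blocks of work registers, and
registers that are reserved for the results. -/
structure Layout (ρ : Type) where
  /-- the registers of the block `g` -/
  cell : ℕ → ℕ → ρ
  cell_inj : ∀ {g i g' i'}, cell g i = cell g' i' → g = g' ∧ i = i'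
  /-- the reserved registers -/
  reserved : Set ρ
  cell_not_mem : ∀ g i, cell g i ∉ reserved

/-- A memory in which the blocks from `next` on have not been used. -/
structure World {ρ : Type} (L : Layout ρ) where
  /-- the first unused block -/
  next : ℕ
  /-- the memory -/
  mem : ρ → ℝ
  fresh : ∀ g, next ≤ g → ∀ i, mem (L.cell g i) = 0

namespace World

variable {ρ : Type} {L : Layout ρ}

/-- Later worlds keep everything outside the blocks that were still free, including the reserved
registers. This is why `Holds` persists along `≤`. -/
instance : Preorder (World L) where
  le w w' := w.next ≤ w'.next ∧
    ∀ r, (∀ g, w.next ≤ g → ∀ i, r ≠ L.cell g i) → w'.mem r = w.mem r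
  le_refl w := ⟨le_rfl, fun _ _ => rfl⟩
  le_trans w₁ w₂ w₃ h h' := ⟨h.1.trans h'.1, fun r hr => by
    rw [h'.2 r fun g hg => hr g (h.1.trans hg), h.2 r hr]⟩

/-- The register `r` is in use and holds the number `v`. -/
structure Holds (w : World L) (r : ρ) (v : ℝ) : Prop where
  not_mem : r ∉ L.reserved
  old : ∀ g, w.next ≤ g → ∀ i, r ≠ L.cell g i
  mem_eq : w.mem r = v

theorem Holds.mono {w w' : World L} {r : ρ} {v : ℝ} (h : w.Holds r v) (hw : w ≤ w') :
    w'.Holds r v :=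
  ⟨h.not_mem, fun g hg => h.old g (hw.1.trans hg), by rw [hw.2 r h.old, h.mem_eq]⟩

/-- The world after the use of one more block. -/
def push (w : World L) (s : ρ → ℝ) (hs : ∀ r, (∀ i, r ≠ L.cell w.next i) → s r = w.mem r) :
    World L where
  next := w.next + 1
  mem := s
  fresh g hg i := by
    rw [hs _ fun j h => by have := (L.cell_inj h).1; omega]
    exact w.fresh g (by omega) i

theorem le_push (w : World L) (s : ρ → ℝ) (hs : ∀ r, (∀ i, r ≠ L.cell w.next i) → s r = w.mem r) :
    w ≤ w.push s hs :=
  ⟨Nat.le_succ _, fun r hr => hs r fun i => hr _ le_rfl i⟩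

theorem holds_push (w : World L) (s : ρ → ℝ)
    (hs : ∀ r, (∀ i, r ≠ L.cell w.next i) → s r = w.mem r) (i : ℕ) :
    (w.push s hs).Holds (L.cell w.next i) (s (L.cell w.next i)) :=
  ⟨L.cell_not_mem _ _, fun g hg j h => by
    have := (L.cell_inj h).1; simp only [push] at hg; omega, rfl⟩

end World

/-- A procedure gets the number of the first unused block, and hands its result and the number
of the first unused block to the rest of the program. -/
def Proc (ρ α : Type) : Type := ℕ → (α → ℕ → RealProg ρ) → RealProg ρ

/-- From the world `w`, the procedure takes time at most `T` and reaches a result and a world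
with the property `Q`. -/
def Spec {ρ α : Type} {L : Layout ρ} (w : World L) (p : Proc ρ α) (T : ℝ)
    (Q : α → World L → Prop) : Prop :=
  ∀ k T' q R, (∀ a w', w ≤ w' → Q a w' → (k a w'.next).Good w'.mem T' q R) →
    (p w.next k).Good w.mem (T + T') q R

namespace Proc

variable {ρ α β : Type}

/-- Return a value. -/
def ret (a : α) : Proc ρ α := fun f k => k a f

/-- Run `p`, and then `g` on its result. -/
def bind (p : Proc ρ α) (g : α → Proc ρ β) : Proc ρ β := fun f k => p f fun a f' => g a f' k

/-- A new register with the constant `v`. -/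
def newConst (L : Layout ρ) (v : ℝ) : Proc ρ ρ :=
  fun f k => .const (L.cell f 0) v (k (L.cell f 0) (f + 1))

/-- A new register with the result of an operation. -/
def newArith (L : Layout ρ) (o : ArithOp) (y z : ρ) : Proc ρ ρ :=
  fun f k => .arith o (L.cell f 0) y z (k (L.cell f 0) (f + 1))

/-- Branch on a comparison. -/
def ifLe (y z : ρ) (p p' : Proc ρ α) : Proc ρ α := fun f k => .branch y z (p f k) (p' f k)

/-- Run the procedures `p i` one after the other. -/
def forFin : (N : ℕ) → (Fin N → Proc ρ α) → Proc ρ (Fin N → α)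
  | 0, _ => ret Fin.elim0
  | N + 1, p => (p 0).bind fun a => (forFin N (Fin.tail p)).bind fun b => ret (Fin.cons a b)

/-- Run the procedures `p i` one after the other. -/
noncomputable def forAll {ι : Type} [Fintype ι] (p : ι → Proc ρ α) : Proc ρ (ι → α) :=
  (forFin (Fintype.card ι) fun i => p ((Fintype.equivFin ι).symm i)).bind
    fun a => ret fun i => a (Fintype.equivFin ι i)

/-- Combine the registers `H i` with an operation. -/
def foldFin (L : Layout ρ) (o : ArithOp) (v : ℝ) : (N : ℕ) → (Fin N → ρ) → Proc ρ ρ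
  | 0, _ => newConst L v
  | N + 1, H => (foldFin L o v N (Fin.tail H)).bind fun r => newArith L o (H 0) r

/-- The sum of the registers `H i`. -/
noncomputable def sum (L : Layout ρ) {ι : Type} [Fintype ι] (H : ι → ρ) : Proc ρ ρ :=
  foldFin L .add 0 (Fintype.card ι) fun i => H ((Fintype.equivFin ι).symm i)

/-- Call a program as a subroutine: its registers are put into a new block. -/
noncomputable def call (L : Layout ρ) {ι κ : Type} [Fintype ι] (enc : Reg ι κ → ℕ)
    (P : RealProg (Reg ι κ)) (args : ι → ρ) : Proc ρ (κ → ρ) := fun f k =>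
  RealProg.copy (Fintype.card ι)
    (fun i => L.cell f (enc (.inp ((Fintype.equivFin ι).symm i))))
    (fun i => args ((Fintype.equivFin ι).symm i))
    ((P.rename fun r => L.cell f (enc r)).seq (k (fun j => L.cell f (enc (.out j))) (f + 1)))

end Proc

section Spec

open Proc

variable {ρ α β : Type} {L : Layout ρ} {w : World L}

theorem Spec.mono {p : Proc ρ α} {T T' : ℝ} {Q Q' : α → World L → Prop} (h : Spec w p T Q)
    (hT : T ≤ T') (hQ : ∀ a w', w ≤ w' → Q a w' → Q' a w') : Spec w p T' Q' :=
  fun k T'' q R hk => (h k T'' q R fun a w' hw hq => hk a w' hw (hQ a w' hw hq)).mono (by linarith)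

theorem Spec.mono_time {p : Proc ρ α} {T T' : ℝ} {Q : α → World L → Prop} (h : Spec w p T Q)
    (hT : T ≤ T') : Spec w p T' Q :=
  h.mono hT fun _ _ _ h => h

theorem spec_ret {a : α} {Q : α → World L → Prop} (h : Q a w) : Spec w (ret a) 0 Q :=
  fun k T' q R hk => by simpa [ret] using hk a w le_rfl h

theorem Spec.bind {p : Proc ρ α} {g : α → Proc ρ β} {T T' : ℝ} {Q : α → World L → Prop}
    {Q' : β → World L → Prop} (hp : Spec w p T Q)
    (hg : ∀ a w', w ≤ w' → Q a w' → Spec w' (g a) T' Q') : Spec w (p.bind g) (T + T') Q' := by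
  intro k T'' q R hk
  rw [add_assoc]
  exact hp _ _ q R fun a w' hw hq => hg a w' hw hq k T'' q R
    fun b w'' hw' hq' => hk b w'' (hw.trans hw') hq'

theorem spec_newConst (v : ℝ) : Spec w (newConst L v) 1 fun r w' => w'.Holds r v := by
  classical
  intro k T' q R hk
  have hs : ∀ r, (∀ i, r ≠ L.cell w.next i) →
      RealProg.write w.mem (L.cell w.next 0) v r = w.mem r :=
    fun r hr => Function.update_of_ne (hr 0) _ _
  refine RealProg.Good.const (hk _ (w.push _ hs) (w.le_push _ hs) ?_)
  have := w.holds_push _ hs 0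
  rwa [show RealProg.write w.mem (L.cell w.next 0) v (L.cell w.next 0) = v from
    Function.update_self _ _ _] at this

theorem spec_newArith (o : ArithOp) {y z : ρ} {a b : ℝ} (hy : w.Holds y a) (hz : w.Holds z b) :
    Spec w (newArith L o y z) 1 fun r w' => w'.Holds r (o.eval a b) := by
  classical
  intro k T' q R hk
  have hs : ∀ r, (∀ i, r ≠ L.cell w.next i) →
      RealProg.write w.mem (L.cell w.next 0) (o.eval (w.mem y) (w.mem z)) r = w.mem r :=
    fun r hr => Function.update_of_ne (hr 0) _ _
  refine RealProg.Good.arith (hk _ (w.push _ hs) (w.le_push _ hs) ?_)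
  have := w.holds_push _ hs 0
  rwa [show RealProg.write w.mem (L.cell w.next 0) (o.eval (w.mem y) (w.mem z)) (L.cell w.next 0) =
    o.eval a b from by rw [hy.mem_eq, hz.mem_eq]; exact Function.update_self _ _ _] at this

theorem spec_ifLe {y z : ρ} {a b : ℝ} (hy : w.Holds y a) (hz : w.Holds z b) {p p' : Proc ρ α}
    {T : ℝ} {Q : α → World L → Prop} (hyes : a ≤ b → Spec w p T Q) (hno : b < a → Spec w p' T Q) :
    Spec w (ifLe y z p p') (1 + T) Q := by
  intro k T' q R hk
  rw [add_assoc]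
  by_cases h : a ≤ b
  · exact .branch_yes (by rwa [hy.mem_eq, hz.mem_eq]) (hyes h k T' q R hk)
  · exact .branch_no (by rwa [hy.mem_eq, hz.mem_eq]) (hno (not_le.1 h) k T' q R hk)

/-- The hypothesis `hmono` says that what holds after one procedure survives the later ones; it is
available because results are never overwritten. -/
theorem spec_forFin {N : ℕ} {p : Fin N → Proc ρ α} {T : Fin N → ℝ} {Q : Fin N → α → World L → Prop}
    (hmono : ∀ i a w₁ w₂, w₁ ≤ w₂ → Q i a w₁ → Q i a w₂)
    (h : ∀ i w', w ≤ w' → Spec w' (p i) (T i) (Q i)) :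
    Spec w (forFin N p) (∑ i, T i) fun a w' => ∀ i, Q i (a i) w' := by
  induction N generalizing w with
  | zero =>
    rw [Fin.sum_univ_zero]
    exact spec_ret fun i => i.elim0
  | succ N ih =>
    rw [Fin.sum_univ_succ]
    refine (h 0 w le_rfl).bind fun a w' hw ha => ?_
    have := ih (w := w') (p := Fin.tail p) (T := fun i => T i.succ) (Q := fun i => Q i.succ)
      (fun i => hmono i.succ) fun i w'' hw' => h i.succ w'' (hw.trans hw')
    rw [← add_zero (∑ i : Fin N, T i.succ)]
    refine this.bind fun b w'' hw' hb => spec_ret fun i => ?_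
    refine Fin.cases ?_ (fun i => ?_) i
    · exact hmono _ _ _ _ hw' ha
    · exact hb i

theorem spec_forAll {ι : Type} [Fintype ι] {p : ι → Proc ρ α} {T : ι → ℝ}
    {Q : ι → α → World L → Prop} (hmono : ∀ i a w₁ w₂, w₁ ≤ w₂ → Q i a w₁ → Q i a w₂)
    (h : ∀ i w', w ≤ w' → Spec w' (p i) (T i) (Q i)) :
    Spec w (forAll p) (∑ i, T i) fun a w' => ∀ i, Q i (a i) w' := by
  rw [← Equiv.sum_comp (Fintype.equivFin ι).symm T, ← add_zero (∑ _, _)]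
  refine (spec_forFin (Q := fun i => Q ((Fintype.equivFin ι).symm i))
    (fun i => hmono _) fun i => h _).bind fun a w' _ ha => spec_ret fun i => ?_
  simpa using ha (Fintype.equivFin ι i)

/-- The value of `Proc.foldFin`. -/
noncomputable def foldVal (o : ArithOp) (v : ℝ) : (N : ℕ) → (Fin N → ℝ) → ℝ
  | 0, _ => v
  | N + 1, x => o.eval (x 0) (foldVal o v N (Fin.tail x))

theorem foldVal_add (N : ℕ) (x : Fin N → ℝ) : foldVal .add 0 N x = ∑ i, x i := by
  induction N with
  | zero => simp [foldVal]
  | succ N ih => rw [foldVal, ih, Fin.sum_univ_succ]; rfl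

theorem foldVal_mul (N : ℕ) (x : Fin N → ℝ) : foldVal .mul 1 N x = ∏ i, x i := by
  induction N with
  | zero => simp [foldVal]
  | succ N ih => rw [foldVal, ih, Fin.prod_univ_succ]; rfl

theorem spec_foldFin (o : ArithOp) (v : ℝ) {N : ℕ} {H : Fin N → ρ} {x : Fin N → ℝ}
    (h : ∀ i, w.Holds (H i) (x i)) :
    Spec w (foldFin L o v N H) (N + 1) fun r w' => w'.Holds r (foldVal o v N x) := by
  induction N with
  | zero => exact (spec_newConst v).mono_time (by simp)
  | succ N ih =>
    push_cast
    exact (ih fun i => h i.succ).bind fun r w' hw hr => spec_newArith o ((h 0).mono hw) hr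

theorem spec_sum {ι : Type} [Fintype ι] {H : ι → ρ} {x : ι → ℝ} (h : ∀ i, w.Holds (H i) (x i)) :
    Spec w (Proc.sum L H) (Fintype.card ι + 1) fun r w' => w'.Holds r (∑ i, x i) := by
  refine (spec_foldFin .add 0 fun i => h _).mono le_rfl fun r w' _ hr => ?_
  rwa [foldVal_add, Equiv.sum_comp (Fintype.equivFin ι).symm x] at hr

/-- A fresh block is all zeros, so after the arguments are copied in, the subroutine sees exactly
`initRegs x`. This is where `World.fresh` is needed. -/
theorem spec_call {ι κ : Type} [Fintype ι] {enc : Reg ι κ → ℕ} (henc : Function.Injective enc)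
    {P : RealProg (Reg ι κ)} {x : ι → ℝ} {T : ℝ} {Φ : (κ → ℝ) → Prop}
    (hT : (P.time (initRegs x) : ℝ) ≤ T)
    (hΦ : ∀ s ∈ (P.run (initRegs x)).support, Φ fun j => s (.out j))
    {args : ι → ρ} (hargs : ∀ i, w.Holds (args i) (x i)) :
    Spec w (call L enc P args) (2 * Fintype.card ι + T)
      fun H w' => ∃ y, Φ y ∧ ∀ j, w'.Holds (H j) (y j) := by
  intro k T' q R hk
  set f := w.next
  set e : Reg ι κ → ρ := fun r => L.cell f (enc r) with he
  have he_inj : Function.Injective e := fun r r' h => henc (L.cell_inj h).2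
  obtain ⟨s', h1, h2, h3⟩ := RealProg.exists_copy (Fintype.card ι)
    (fun i => e (.inp ((Fintype.equivFin ι).symm i)))
    (fun i => args ((Fintype.equivFin ι).symm i))
    (fun i j h => by simpa using he_inj h)
    (fun i j => (hargs _).old f le_rfl _) w.mem
  have hs' : s' ∘ e = initRegs x := by
    funext r
    cases r with
    | inp i =>
      have := h1 (Fintype.equivFin ι i)
      simp only [Equiv.symm_apply_apply, (hargs _).mem_eq] at this
      exact this
    | out j =>
      rw [Function.comp_apply, h2 _ fun i h => by simpa using he_inj h]
      exact w.fresh f le_rfl _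
    | tmp t =>
      rw [Function.comp_apply, h2 _ fun i h => by simpa using he_inj h]
      exact w.fresh f le_rfl _
  rw [add_assoc]
  refine h3 _ _ q R (RealProg.Good.seq ?_ fun u hu => ?_)
  · rwa [RealProg.time_rename he_inj, hs']
  · rw [RealProg.run_rename he_inj, hs', PMF.support_map] at hu
    obtain ⟨u₀, hu₀, rfl⟩ := hu
    have hs : ∀ r, (∀ i, r ≠ L.cell w.next i) → Function.extend e u₀ s' r = w.mem r := by
      intro r hr
      rw [Function.extend_apply' _ _ _ fun ⟨a, ha⟩ => hr _ ha.symm, h2 r fun i => hr _]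
    refine hk _ (w.push _ hs) (w.le_push _ hs) ⟨_, hΦ u₀ hu₀, fun j => ?_⟩
    have := w.holds_push _ hs (enc (.out j))
    rwa [show L.cell w.next (enc (.out j)) = e (.out j) from rfl, he_inj.extend_apply] at this

end Spec

theorem Reg.exists_injective_nat (ι κ : Type) [Countable ι] [Countable κ] :
    ∃ enc : Reg ι κ → ℕ, Function.Injective enc := by
  have : Countable (Reg ι κ) := by
    refine Function.Injective.countable
      (f := fun r : Reg ι κ => match r with
        | .inp i => (Sum.inl i : ι ⊕ (κ ⊕ ℕ))
        | .out j => Sum.inr (Sum.inl j)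
        | .tmp t => Sum.inr (Sum.inr t)) ?_
    intro a b h
    cases a <;> cases b <;> simp_all
  exact Countable.exists_injective_nat _

/-! ### Coin tosses -/

section Toss

variable {ρ : Type} {L : Layout ρ}

/-- Toss a coin for every `i`. -/
noncomputable def tossAll (L : Layout ρ) {ι : Type} [Fintype ι] : Proc ρ (ι → ρ) := fun f k =>
  RealProg.toss (Fintype.card ι) (fun i => L.cell f i)
    (k (fun i => L.cell f (Fintype.equivFin ι i)) (f + 1))

/-- The indicator as success probability makes the continuation succeed surely for signs in `E` and
asks for nothing but the time bound otherwise. `Spec` could not express this, as it requires one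
probability for all outcomes. -/
theorem good_tossAll {ι : Type} [Fintype ι] [DecidableEq ι] (w : World L) (k : (ι → ρ) → ℕ → RealProg ρ)
    (E : Set (ι → Bool)) (T : ℝ) (R : Set (ρ → ℝ))
    (h : ∀ H b w', w ≤ w' → (∀ i, w'.Holds (H i) (sgn (b i))) →
      (k H w'.next).Good w'.mem T (E.indicator (fun _ => 1) b) R) :
    (tossAll L w.next k).Good w.mem (Fintype.card ι + T) (ENNReal.ofReal (prob E)) R := by
  set e := Fintype.equivFin ι
  set dst : Fin (Fintype.card ι) → ρ := fun i => L.cell w.next i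
  have hd : Function.Injective dst := fun i j h => Fin.ext (L.cell_inj h).2
  have hs : ∀ b r, (∀ i, r ≠ L.cell w.next i) →
      RealProg.tossed _ dst w.mem b r = w.mem r :=
    fun b r hr => RealProg.tossed_of_ne _ _ _ _ _ fun i => hr i
  have key : ∀ b : Fin (Fintype.card ι) → Bool,
      (k (fun i => L.cell w.next (e i)) (w.next + 1)).Good (RealProg.tossed _ dst w.mem b) T
        (E.indicator (fun _ => 1) fun i => b (e i)) R := fun b =>
    h _ (fun i => b (e i)) (w.push _ (hs b)) (w.le_push _ _) fun i => by
      have := w.holds_push _ (hs b) (e i)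
      rwa [show RealProg.tossed _ dst w.mem b (L.cell w.next (e i)) = sgn (b (e i)) from
        RealProg.tossed_apply _ dst hd _ _ _] at this
  refine ⟨RealProg.time_toss_le _ _ _ _ _ fun b => (key b).time_le, ?_⟩
  have hE : prob E = prob {b : Fin (Fintype.card ι) → Bool | (fun i => b (e i)) ∈ E} :=
    (avg_equiv (e.symm.arrowCongr (Equiv.refl Bool)) (E.indicator fun _ => (1 : ℝ))).symm
  rw [hE]
  refine RealProg.prob_le_toss _ _ _ _ _ _ fun b hb => ?_
  have := (key b).le_prob
  rwa [Set.indicator_of_mem (show (fun i => b (e i)) ∈ E from hb)] at this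

end Toss

/-! ### Matrix multiplication -/

/-- The registers `H` hold the matrix `M`. -/
def World.HoldsMat {ρ : Type} {L : Layout ρ} (w : World L) {a b : ℕ} (H : Fin a → Fin b → ρ)
    (M : Matrix (Fin a) (Fin b) ℝ) : Prop :=
  ∀ i j, w.Holds (H i j) (M i j)

theorem World.HoldsMat.mono {ρ : Type} {L : Layout ρ} {w w' : World L} {a b : ℕ}
    {H : Fin a → Fin b → ρ} {M : Matrix (Fin a) (Fin b) ℝ} (h : w.HoldsMat H M) (hw : w ≤ w') :
    w'.HoldsMat H M :=
  fun i j => (h i j).mono hw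

theorem exists_square_mul {ω : ℝ} (hω : 2 ≤ ω) (hmul : IsMatMulExponent ω) :
    ∃ K : ℝ, 0 ≤ K ∧ ∀ {ρ : Type} (L : Layout ρ) (N : ℕ), 1 ≤ N →
      ∃ mul : (Fin N → Fin N → ρ) → (Fin N → Fin N → ρ) → Proc ρ (Fin N → Fin N → ρ),
        ∀ (w : World L) A B HA HB, w.HoldsMat HA A → w.HoldsMat HB B →
          Spec w (mul HA HB) (K * (N : ℝ) ^ ω) fun H w' => w'.HoldsMat H (A * B) := by
  obtain ⟨K, hK⟩ := hmul
  -- The `4` pays for copying the `2 * N ^ 2` arguments at two instructions each; this uses `2 ≤ ω`.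
  refine ⟨|K| + 4, by positivity, fun {ρ} L N hN => ?_⟩
  obtain ⟨P, hP⟩ := hK N hN
  obtain ⟨enc, henc⟩ := Reg.exists_injective_nat ((Fin N × Fin N) ⊕ (Fin N × Fin N)) (Fin N × Fin N)
  refine ⟨fun HA HB => (Proc.call L enc P
    (Sum.elim (fun p => HA p.1 p.2) (fun p => HB p.1 p.2))).bind
      fun H => Proc.ret fun i j => H (i, j), fun w A B HA HB hA hB => ?_⟩
  have h := spec_call (w := w) henc (hP A B).1 (Φ := fun y => ∀ i j, y (i, j) = (A * B) i j)
    (fun s hs i j => by rw [← (hP A B).2 s hs]; rfl)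
    (args := Sum.elim (fun p => HA p.1 p.2) (fun p => HB p.1 p.2))
    (by rintro (p | p) <;> [exact hA _ _; exact hB _ _])
  refine (h.bind (T' := 0) fun H w' _ hH => spec_ret ?_).mono (Q := fun H w' =>
    w'.HoldsMat H (A * B)) ?_ fun _ _ _ h => h
  · obtain ⟨y, hy, hH⟩ := hH
    intro i j
    have := hH (i, j)
    rwa [hy] at this
  · have h1 : (1 : ℝ) ≤ N := by exact_mod_cast hN
    have h2 : (N : ℝ) ^ (2 : ℝ) ≤ (N : ℝ) ^ ω := Real.rpow_le_rpow_of_exponent_le h1 hω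
    rw [Real.rpow_two] at h2
    have h3 : K * (N : ℝ) ^ ω ≤ |K| * (N : ℝ) ^ ω :=
      mul_le_mul_of_nonneg_right (le_abs_self K) (by positivity)
    simp only [Fintype.card_sum, Fintype.card_prod, Fintype.card_fin]
    push_cast
    nlinarith

/-- The entry `(x, y)` of a matrix, and `z` beyond the border. -/
def padEntry {α : Type} (z : α) {a b : ℕ} (M : Fin a → Fin b → α) (x y : ℕ) : α :=
  if h : x < a ∧ y < b then M ⟨x, h.1⟩ ⟨y, h.2⟩ else z

theorem World.HoldsMat.padEntry {ρ : Type} {L : Layout ρ} {w : World L} {a b : ℕ}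
    {H : Fin a → Fin b → ρ} {M : Matrix (Fin a) (Fin b) ℝ} (h : w.HoldsMat H M) {z : ρ}
    (hz : w.Holds z 0) (x y : ℕ) :
    w.Holds (_root_.padEntry z H x y) (_root_.padEntry 0 M x y) := by
  unfold _root_.padEntry
  split_ifs
  · exact h _ _
  · exact hz

/-- The number of blocks of size `d` that cover `a`. -/
def numBlocks (a d : ℕ) : ℕ := (a + d - 1) / d

theorem le_mul_numBlocks {a d : ℕ} (hd : 1 ≤ d) : a ≤ numBlocks a d * d := by
  have h1 := Nat.div_add_mod (a + d - 1) d
  have h2 := Nat.mod_lt (a + d - 1) hd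
  rw [numBlocks, mul_comm]
  omega

theorem numBlocks_le {a d : ℕ} (hd : 1 ≤ d) (h : d ≤ a) : (numBlocks a d : ℝ) ≤ 2 * a / d := by
  rw [le_div_iff₀ (by positivity)]
  have : numBlocks a d * d ≤ 2 * a := (Nat.div_mul_le_self _ _).trans (by omega)
  exact_mod_cast this

theorem div_lt_numBlocks {a d : ℕ} (hd : 1 ≤ d) (i : Fin a) : (i : ℕ) / d < numBlocks a d := by
  rw [Nat.div_lt_iff_lt_mul hd]
  exact i.2.trans_le (le_mul_numBlocks hd)

/-- The block `(I, J)` of a matrix, padded with `z`. -/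
def block {α : Type} (z : α) {a b : ℕ} (M : Fin a → Fin b → α) (d I J : ℕ) :
    Fin d → Fin d → α :=
  fun p q => padEntry z M (p + d * I) (q + d * J)

theorem World.HoldsMat.block {ρ : Type} {L : Layout ρ} {w : World L} {a b : ℕ}
    {H : Fin a → Fin b → ρ} {M : Matrix (Fin a) (Fin b) ℝ} (h : w.HoldsMat H M) {z : ρ}
    (hz : w.Holds z 0) (d I J : ℕ) :
    w.HoldsMat (_root_.block z H d I J) (Matrix.of (_root_.block 0 M d I J)) :=
  fun _ _ => h.padEntry hz _ _

/-- The pairs of a block index `J` and an offset `q` enumerate the inner index `q + d * J`. Indices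
past `b` contribute zero by the padding. -/
theorem sum_block_mul {a b c d : ℕ} (hd : 1 ≤ d) (A : Matrix (Fin a) (Fin b) ℝ)
    (B : Matrix (Fin b) (Fin c) ℝ) (i : Fin a) (k : Fin c) :
    ∑ J : Fin (numBlocks b d),
      ((Matrix.of (block 0 A d (i / d) J) : Matrix (Fin d) (Fin d) ℝ) *
        Matrix.of (block 0 B d J (k / d))) ⟨i % d, Nat.mod_lt _ hd⟩ ⟨k % d, Nat.mod_lt _ hd⟩ =
      (A * B) i k := by
  have h1 : ∀ J : Fin (numBlocks b d),
      ((Matrix.of (block 0 A d (i / d) J) : Matrix (Fin d) (Fin d) ℝ) *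
        Matrix.of (block 0 B d J (k / d))) ⟨i % d, Nat.mod_lt _ hd⟩ ⟨k % d, Nat.mod_lt _ hd⟩ =
      ∑ q : Fin d, (fun x : ℕ => padEntry 0 A i x * padEntry 0 B x k)
        (finProdFinEquiv (J, q) : Fin (numBlocks b d * d)) := by
    intro J
    simp only [Matrix.mul_apply, Matrix.of_apply, block, Nat.mod_add_div, finProdFinEquiv_apply_val]
  simp only [h1]
  rw [← Fintype.sum_prod_type', Equiv.sum_comp finProdFinEquiv
    fun x : Fin (numBlocks b d * d) => padEntry 0 A i x * padEntry 0 B x k,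
    Fin.sum_univ_eq_sum_range (fun x => padEntry 0 A i x * padEntry 0 B x k),
    ← Finset.sum_range_add_sum_Ico _ (le_mul_numBlocks hd), Finset.sum_eq_zero (s := Finset.Ico _ _),
    add_zero, ← Fin.sum_univ_eq_sum_range (fun x => padEntry 0 A i x * padEntry 0 B x k),
    Matrix.mul_apply]
  · exact Finset.sum_congr rfl fun x _ => by simp [padEntry]
  · intro x hx
    have := (Finset.mem_Ico.1 hx).1
    simp [padEntry, not_lt.2 this]

/-- Rectangular matrices can be multiplied by splitting them into blocks: `d` is the smallest
of the three dimensions. -/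
def HasMul (ω K : ℝ) : Prop :=
  ∀ {ρ : Type} (L : Layout ρ) (a b c d : ℕ), 1 ≤ d → d ≤ a → d ≤ b → d ≤ c →
    ∃ mul : (Fin a → Fin b → ρ) → (Fin b → Fin c → ρ) → Proc ρ (Fin a → Fin c → ρ),
      ∀ (w : World L) A B HA HB, w.HoldsMat HA A → w.HoldsMat HB B →
        Spec w (mul HA HB) (K * (a * b * c / d * (d : ℝ) ^ (ω - 2)))
          fun H w' => w'.HoldsMat H (A * B)

theorem exists_hasMul {ω : ℝ} (hω : 2 ≤ ω) (hmul : IsMatMulExponent ω) :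
    ∃ K : ℝ, 1 ≤ K ∧ HasMul ω K := by
  obtain ⟨K, hK0, hK⟩ := exists_square_mul hω hmul
  -- Rounding up the numbers of blocks costs a factor at most `2` in each of three dimensions, hence
  -- `8 * K`; adding the block products costs at most `3 * (a * b * c / d)`, and the zero register
  -- costs one more instruction.
  refine ⟨8 * K + 4, by linarith, fun {ρ} L a b c d hd ha hb hc => ?_⟩
  obtain ⟨sq, hsq⟩ := hK L d hd
  refine ⟨fun HA HB => (Proc.newConst L 0).bind fun z =>
    (Proc.forAll fun I : Fin (numBlocks a d) × Fin (numBlocks b d) × Fin (numBlocks c d) =>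
      sq (block z HA d I.1 I.2.1) (block z HB d I.2.1 I.2.2)).bind fun Hs =>
    (Proc.forAll fun p : Fin a × Fin c => Proc.sum L fun J : Fin (numBlocks b d) =>
      Hs (⟨p.1 / d, div_lt_numBlocks hd _⟩, J, ⟨p.2 / d, div_lt_numBlocks hd _⟩)
        ⟨p.1 % d, Nat.mod_lt _ hd⟩ ⟨p.2 % d, Nat.mod_lt _ hd⟩).bind fun H =>
    Proc.ret fun i k => H (i, k), fun w A B HA HB hA hB => ?_⟩
  refine Spec.mono_time (T := 1 + ((∑ I : Fin (numBlocks a d) × Fin (numBlocks b d) ×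
    Fin (numBlocks c d), K * (d : ℝ) ^ ω) +
    ((∑ p : Fin a × Fin c, ((Fintype.card (Fin (numBlocks b d)) : ℝ) + 1)) + 0))) ?_ ?_
  · refine (spec_newConst 0).bind fun z w₁ hw₁ hz => ?_
    have hblocks := spec_forAll (w := w₁)
      (p := fun I : Fin (numBlocks a d) × Fin (numBlocks b d) × Fin (numBlocks c d) =>
        sq (block z HA d I.1 I.2.1) (block z HB d I.2.1 I.2.2))
      (T := fun _ => K * (d : ℝ) ^ ω)
      (Q := fun I H w' => w'.HoldsMat H
        ((Matrix.of (block 0 A d I.1 I.2.1) : Matrix (Fin d) (Fin d) ℝ) *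
          Matrix.of (block 0 B d I.2.1 I.2.2)))
      (fun I H w' w'' hw h => World.HoldsMat.mono h hw) fun I w₂ hw₂ => by
        have hA₂ : w₂.HoldsMat HA A := hA.mono (hw₁.trans hw₂)
        have hB₂ : w₂.HoldsMat HB B := hB.mono (hw₁.trans hw₂)
        have hz₂ : w₂.Holds z 0 := hz.mono hw₂
        exact hsq w₂ _ _ _ _ (hA₂.block hz₂ d I.1 I.2.1) (hB₂.block hz₂ d I.2.1 I.2.2)
    refine hblocks.bind fun Hs w₂ hw₂ hHs => ?_
    refine (spec_forAll (Q := fun p r w' => w'.Holds r ((A * B) p.1 p.2))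
      (fun p r w' w'' hw h => World.Holds.mono h hw) fun p w₃ hw₃ => ?_).bind
        fun H w₃ hw₃ hH => spec_ret fun i k => hH (i, k)
    rw [← sum_block_mul hd A B p.1 p.2]
    exact spec_sum fun J => World.Holds.mono (hHs _ _ _) hw₃
  · have hd1 : (1 : ℝ) ≤ d := by exact_mod_cast hd
    have hd0 : (0 : ℝ) < d := by positivity
    have hu : 1 ≤ (d : ℝ) ^ (ω - 2) := Real.one_le_rpow hd1 (by linarith)
    have hdω : (d : ℝ) ^ ω = d ^ 2 * (d : ℝ) ^ (ω - 2) := by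
      rw [← Real.rpow_two, ← Real.rpow_add hd0]; congr 1; ring
    have ha' : (d : ℝ) ≤ a := by exact_mod_cast ha
    have hb' : (d : ℝ) ≤ b := by exact_mod_cast hb
    have hc' : (d : ℝ) ≤ c := by exact_mod_cast hc
    have na := numBlocks_le hd ha
    have nb := numBlocks_le hd hb
    have nc := numBlocks_le hd hc
    simp only [Finset.sum_const, Finset.card_univ, Fintype.card_prod, Fintype.card_fin,
      nsmul_eq_mul, Nat.cast_mul, add_zero]
    set X : ℝ := a * b * c / d
    set u : ℝ := (d : ℝ) ^ (ω - 2)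
    have hX1 : 1 ≤ X := by
      rw [one_le_div hd0]
      calc (d : ℝ) = d * 1 * 1 := by ring
        _ ≤ a * b * c := by gcongr <;> linarith
    have hX : X ≤ X * u := le_mul_of_one_le_right (by linarith) hu
    have e1 : (numBlocks a d : ℝ) * (numBlocks b d * numBlocks c d) * (K * (d : ℝ) ^ ω) ≤
        8 * K * (X * u) := by
      calc _ ≤ (2 * a / d) * ((2 * b / d) * (2 * c / d)) * (K * (d : ℝ) ^ ω) := by gcongr
        _ = 8 * K * (X * u) := by rw [hdω]; simp only [X]; field_simp; ring
    have e2 : (a : ℝ) * c * (numBlocks b d + 1) ≤ 3 * X := by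
      calc _ ≤ (a : ℝ) * c * (2 * b / d + b / d) := by
            gcongr
            rwa [one_le_div hd0]
        _ = 3 * X := by simp only [X]; ring
    nlinarith

/-! ### Storing the results -/

section Store

variable {ρ ι : Type} [Fintype ι] {L : Layout ρ}

/-- Copy the registers `H` to the registers `dst`, and terminate. -/
noncomputable def store (dst H : ι → ρ) : RealProg ρ :=
  RealProg.copy (Fintype.card ι) (fun i => dst ((Fintype.equivFin ι).symm i))
    (fun i => H ((Fintype.equivFin ι).symm i)) .halt

theorem good_store {w : World L} {dst H : ι → ρ} {v : ι → ℝ} {R : Set (ρ → ℝ)}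
    (hinj : Function.Injective dst) (hdst : ∀ i, dst i ∈ L.reserved)
    (hH : ∀ i, w.Holds (H i) (v i))
    (hR : ∀ s, (∀ i, s (dst i) = v i) → (∀ r, r ∉ L.reserved → s r = w.mem r) → s ∈ R) :
    (store dst H).Good w.mem (2 * Fintype.card ι) 1 R := by
  obtain ⟨s, h1, h2, h3⟩ := RealProg.exists_copy (Fintype.card ι)
    (fun i => dst ((Fintype.equivFin ι).symm i)) (fun i => H ((Fintype.equivFin ι).symm i))
    (fun i j h => by simpa using hinj h)
    (fun i j h => (hH _).not_mem (h ▸ hdst _)) w.mem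
  refine (h3 .halt 0 1 R ⟨by simp [RealProg.time], ?_⟩).mono (by simp)
  have hs : s ∈ R := hR s
    (fun i => by
      have := h1 (Fintype.equivFin ι i)
      simpa [(hH _).mem_eq] using this)
    (fun r hr => h2 r fun i h => hr (h ▸ hdst _))
  classical
  simp [RealProg.run, PMF.toOuterMeasure_pure_apply, hs]

end Store

/-! ### The exact product of a chain -/

/-- The registers `HA` hold the chain `A 0, …, A m`. -/
def HoldsChain {ρ : Type} {L : Layout ρ} (w : World L) {n : ℕ → ℕ} {m : ℕ}
    (HA : (l : Fin (m + 1)) → Fin (n l) → Fin (n (l + 1)) → ρ)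
    (A : (l : ℕ) → Matrix (Fin (n l)) (Fin (n (l + 1))) ℝ) : Prop :=
  ∀ l : Fin (m + 1), w.HoldsMat (HA l) (A l)

theorem HoldsChain.mono {ρ : Type} {L : Layout ρ} {w w' : World L} {n : ℕ → ℕ} {m : ℕ}
    {HA : (l : Fin (m + 1)) → Fin (n l) → Fin (n (l + 1)) → ρ}
    {A : (l : ℕ) → Matrix (Fin (n l)) (Fin (n (l + 1))) ℝ} (h : HoldsChain w HA A) (hw : w ≤ w') :
    HoldsChain w' HA A :=
  fun l => World.HoldsMat.mono (h l) hw

/-- The identity matrix. -/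
noncomputable def oneProc {ρ : Type} (L : Layout ρ) (a : ℕ) : Proc ρ (Fin a → Fin a → ρ) :=
  (Proc.forAll fun p : Fin a × Fin a =>
    Proc.newConst L ((1 : Matrix (Fin a) (Fin a) ℝ) p.1 p.2)).bind
      fun H => Proc.ret fun i j => H (i, j)

theorem spec_oneProc {ρ : Type} {L : Layout ρ} (w : World L) (a : ℕ) :
    Spec w (oneProc L a) (a ^ 2) fun H w' => w'.HoldsMat H (1 : Matrix (Fin a) (Fin a) ℝ) := by
  refine ((spec_forAll (Q := fun p r w' => w'.Holds r ((1 : Matrix (Fin a) (Fin a) ℝ) p.1 p.2))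
    (fun p r w' w'' hw h => World.Holds.mono h hw) fun p w₃ hw₃ => spec_newConst _).bind
        fun H w₃ hw₃ hH => spec_ret fun i k => hH (i, k)).mono_time (le_of_eq ?_)
  simp [sq]

section Chain

variable {ρ : Type} {ω K : ℝ}

/-- Multiplying from the split point outwards keeps `n j`, the smallest dimension, in every product,
so a step costs `n l * n (l + 1) * (n j) ^ (ω - 2)`. The equation for `Q` characterises the partial
product `A i ⋯ A (j - 1)` only through its use, which avoids a separate definition. -/
theorem HasMul.exists_left_factor (hK : HasMul ω K) (L : Layout ρ) {n : ℕ → ℕ} {m : ℕ}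
    (HA : (l : Fin (m + 1)) → Fin (n l) → Fin (n (l + 1)) → ρ) {j : ℕ} (hj : j ≤ m + 1)
    (hmin : ∀ i ≤ m + 1, n j ≤ n i) (hpos : 1 ≤ n j) (e : ℕ) : ∀ i, i + e = j →
    ∃ p : Proc ρ (Fin (n i) → Fin (n j) → ρ), ∀ (w : World L) A, HoldsChain w HA A →
      Spec w p ((n j : ℝ) ^ 2 +
          K * (n j : ℝ) ^ (ω - 2) * ∑ l ∈ Finset.Ico i j, (n l * n (l + 1) : ℝ))
        fun H w' => ∃ Q : Matrix (Fin (n i)) (Fin (n j)) ℝ, w'.HoldsMat H Q ∧ chainProd A i * Q = chainProd A j := by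
  induction e with
  | zero =>
    rintro i rfl
    exact ⟨oneProc L (n i), fun w A hA => (spec_oneProc w _).mono (by simp)
      fun H w' _ h => ⟨1, h, Matrix.mul_one _⟩⟩
  | succ e ih =>
    intro i hi
    obtain ⟨p, hp⟩ := ih (i + 1) (by omega)
    obtain ⟨mul, hmul⟩ := hK L (n i) (n (i + 1)) (n j) (n j) hpos (hmin i (by omega))
      (hmin _ (by omega)) le_rfl
    refine ⟨p.bind fun H => mul (HA ⟨i, by omega⟩) H, fun w A hA => ?_⟩
    refine ((hp w A hA).bind (T' := K * ((n i * n (i + 1) * n j / n j : ℝ) * (n j : ℝ) ^ (ω - 2)))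
      (Q' := fun H w' => ∃ Q : Matrix (Fin (n i)) (Fin (n j)) ℝ, w'.HoldsMat H Q ∧ chainProd A i * Q = chainProd A j)
      fun H w' hw ⟨Q, hQ, hQ'⟩ => ?_).mono_time (le_of_eq ?_)
    · refine (hmul w' (A i) Q _ _ (hA.mono hw ⟨i, by omega⟩) hQ).mono le_rfl
        fun H' w'' _ hH' => ⟨_, hH', ?_⟩
      rw [← Matrix.mul_assoc, ← hQ']
      rfl
    · have : (n j : ℝ) ≠ 0 := by positivity
      rw [Finset.sum_eq_sum_Ico_succ_bot (by omega : i < j), mul_div_assoc, div_self this]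
      ring

theorem HasMul.exists_right_factor (hK : HasMul ω K) (L : Layout ρ) {n : ℕ → ℕ} {m : ℕ}
    (HA : (l : Fin (m + 1)) → Fin (n l) → Fin (n (l + 1)) → ρ) {j : ℕ}
    (hmin : ∀ i ≤ m + 1, n j ≤ n i) (hpos : 1 ≤ n j) (i : ℕ) (hji : j ≤ i) : i ≤ m + 1 →
    ∃ p : Proc ρ (Fin (n j) → Fin (n i) → ρ), ∀ (w : World L) A, HoldsChain w HA A →
      Spec w p ((n j : ℝ) ^ 2 +
          K * (n j : ℝ) ^ (ω - 2) * ∑ l ∈ Finset.Ico j i, (n l * n (l + 1) : ℝ))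
        fun H w' => ∃ Q : Matrix (Fin (n j)) (Fin (n i)) ℝ, w'.HoldsMat H Q ∧ chainProd A j * Q = chainProd A i := by
  induction i, hji using Nat.le_induction with
  | base =>
    exact fun _ => ⟨oneProc L (n j), fun w A hA => (spec_oneProc w _).mono (by simp)
      fun H w' _ h => ⟨1, h, Matrix.mul_one _⟩⟩
  | succ i hji ih =>
    intro hi
    obtain ⟨p, hp⟩ := ih (by omega)
    obtain ⟨mul, hmul⟩ := hK L (n j) (n i) (n (i + 1)) (n j) hpos le_rfl (hmin i (by omega))
      (hmin _ (by omega))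
    refine ⟨p.bind fun H => mul H (HA ⟨i, by omega⟩), fun w A hA => ?_⟩
    refine ((hp w A hA).bind (T' := K * ((n j * n i * n (i + 1) / n j : ℝ) * (n j : ℝ) ^ (ω - 2)))
      (Q' := fun H w' => ∃ Q : Matrix (Fin (n j)) (Fin (n (i + 1))) ℝ, w'.HoldsMat H Q ∧ chainProd A j * Q = chainProd A (i + 1))
      fun H w' hw ⟨Q, hQ, hQ'⟩ => ?_).mono_time (le_of_eq ?_)
    · refine (hmul w' Q (A i) _ _ hQ (hA.mono hw ⟨i, by omega⟩)).mono le_rfl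
        fun H' w'' _ hH' => ⟨_, hH', ?_⟩
      rw [← Matrix.mul_assoc, hQ']
      rfl
    · have : (n j : ℝ) ≠ 0 := by positivity
      rw [Finset.sum_Ico_succ_top (by omega : j ≤ i)]
      field_simp
      ring

/-- The exact product as a product of two factors, split where the dimension is the smallest. -/
theorem HasMul.exists_factors (hK : HasMul ω K) (hω : 2 ≤ ω) (L : Layout ρ) {n : ℕ → ℕ} {m : ℕ}
    (HA : (l : Fin (m + 1)) → Fin (n l) → Fin (n (l + 1)) → ρ) {j : ℕ} (hj : j ≤ m + 1)
    (hmin : ∀ i ≤ m + 1, n j ≤ n i) (hpos : 1 ≤ n j) :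
    ∃ p : Proc ρ ((Fin (n 0) → Fin (n j) → ρ) × (Fin (n j) → Fin (n (m + 1)) → ρ)),
      ∀ (w : World L) A, HoldsChain w HA A →
        Spec w p ((K + 2) * inputSize n m * (n j : ℝ) ^ (ω - 2)) fun H w' =>
          ∃ (U : Matrix (Fin (n 0)) (Fin (n j)) ℝ) (V : Matrix (Fin (n j)) (Fin (n (m + 1))) ℝ),
            w'.HoldsMat H.1 U ∧ w'.HoldsMat H.2 V ∧ U * V = chainProd A (m + 1) := by
  obtain ⟨p, hp⟩ := hK.exists_left_factor L HA hj hmin hpos j 0 (by omega)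
  obtain ⟨p', hp'⟩ := hK.exists_right_factor L HA hmin hpos (m + 1) hj le_rfl
  refine ⟨p.bind fun H => p'.bind fun H' => Proc.ret (H, H'), fun w A hA => ?_⟩
  refine ((hp w A hA).bind fun H w' hw ⟨U, hU, hU'⟩ =>
    (hp' w' A (hA.mono hw)).bind (T' := 0) (Q' := fun (H : (Fin (n 0) → Fin (n j) → ρ) ×
            (Fin (n j) → Fin (n (m + 1)) → ρ)) w' =>
          ∃ (U : Matrix (Fin (n 0)) (Fin (n j)) ℝ) (V : Matrix (Fin (n j)) (Fin (n (m + 1))) ℝ),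
            w'.HoldsMat H.1 U ∧ w'.HoldsMat H.2 V ∧ U * V = chainProd A (m + 1))
      fun H' w'' hw' ⟨V, hV, hV'⟩ => spec_ret ⟨U, V, hU.mono hw', hV, ?_⟩).mono_time ?_
  · rw [← hV', ← hU']
    simp [chainProd]
  · have hs : (inputSize n m : ℝ) = ∑ l ∈ Finset.Ico 0 (m + 1), (n l * n (l + 1) : ℝ) := by
      simp [inputSize]
    have hsq : (n j : ℝ) ^ 2 ≤ inputSize n m := by
      have : n j ^ 2 ≤ inputSize n m :=
        le_trans (by rw [sq]; exact Nat.mul_le_mul (hmin 0 (by omega)) (hmin 1 (by omega)))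
          (Finset.single_le_sum (f := fun l => n l * n (l + 1)) (fun _ _ => Nat.zero_le _)
            (Finset.mem_range.2 (Nat.succ_pos m)))
      exact_mod_cast this
    have hu : 1 ≤ (n j : ℝ) ^ (ω - 2) :=
      Real.one_le_rpow (by exact_mod_cast hpos) (by linarith)
    have h2 := mul_le_mul hsq hu zero_le_one (Nat.cast_nonneg _)
    have h3 := Finset.sum_Ico_consecutive (fun l => (n l * n (l + 1) : ℝ)) (Nat.zero_le j) hj
    rw [← hs] at h3
    rw [← h3] at h2 ⊢
    linarith

/-- The exact product. -/
theorem HasMul.exists_chainProd (hK : HasMul ω K) (hω : 2 ≤ ω) (L : Layout ρ) {n : ℕ → ℕ} {m : ℕ}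
    (HA : (l : Fin (m + 1)) → Fin (n l) → Fin (n (l + 1)) → ρ) {j : ℕ} (hj : j ≤ m + 1)
    (hmin : ∀ i ≤ m + 1, n j ≤ n i) (hpos : 1 ≤ n j) :
    ∃ p : Proc ρ (Fin (n 0) → Fin (n (m + 1)) → ρ),
      ∀ (w : World L) A, HoldsChain w HA A →
        Spec w p ((K + 2) * inputSize n m * (n j : ℝ) ^ (ω - 2) +
            K * (n 0 * n (m + 1) * (n j : ℝ) ^ (ω - 2)))
          fun H w' => w'.HoldsMat H (chainProd A (m + 1)) := by
  obtain ⟨p, hp⟩ := hK.exists_factors hω L HA hj hmin hpos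
  obtain ⟨mul, hmul⟩ := hK L (n 0) (n j) (n (m + 1)) (n j) hpos (hmin 0 (by omega)) le_rfl
      (hmin _ le_rfl)
  refine ⟨p.bind fun H => mul H.1 H.2, fun w A hA => ((hp w A hA).bind
    fun H w' hw ⟨U, V, hU, hV, hUV⟩ => hUV ▸ hmul w' U V _ _ hU hV).mono_time (le_of_eq ?_)⟩
  have : (n j : ℝ) ≠ 0 := by positivity
  field_simp

/-! ### The sketched product of a chain -/

/-- The tug-of-war sketch with the given signs. -/
noncomputable def scaleProc (L : Layout ρ) {c q : ℕ} (H : Fin c → Fin q → ρ) :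
    Proc ρ (Fin c → Fin q → ρ) :=
  (Proc.newConst L (1 / Real.sqrt c)).bind fun z =>
    (Proc.forAll fun p : Fin c × Fin q => Proc.newArith L .mul (H p.1 p.2) z).bind
      fun H => Proc.ret fun i j => H (i, j)

theorem spec_scaleProc {L : Layout ρ} (w : World L) {c q : ℕ} {H : Fin c → Fin q → ρ}
    {h : Fin c → Fin q → Bool} (hH : ∀ i j, w.Holds (H i j) (sgn (h i j))) :
    Spec w (scaleProc L H) (1 + c * q) fun H w' => w'.HoldsMat H (tugOfWar h) := by
  refine ((spec_newConst _).bind fun z w₁ hw₁ hz =>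
    (spec_forAll (Q := fun p r w' => w'.Holds r (tugOfWar h p.1 p.2)) (T := fun _ => 1)
      (fun p r w' w'' hw h => World.Holds.mono h hw) fun p w₂ hw₂ => ?_).bind (T' := 0)
        fun H w₃ hw₃ hH => spec_ret fun i k => hH (i, k)).mono_time (le_of_eq ?_)
  · refine (spec_newArith .mul ((hH p.1 p.2).mono (hw₁.trans hw₂)) (hz.mono hw₂)).mono le_rfl
      fun r w' _ hr => ?_
    have : ArithOp.mul.eval (sgn (h p.1 p.2)) (1 / Real.sqrt c) = tugOfWar h p.1 p.2 := by
      simp [ArithOp.eval, tugOfWar, sgn, div_eq_mul_inv]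
    rwa [this] at hr
  · simp

/-- A junction is evaluated as `(X Sᵀ) (S A)`. Each of the three multiplications then has `c` as its
smallest dimension and two different `n i`, `n j` as the others, so it costs at most `K * M * c ^ (ω
- 2)`. The transpose is free: it only renames registers. -/
theorem HasMul.exists_sketchedProd (hK : HasMul ω K) (hK0 : 0 ≤ K) (hω : 2 ≤ ω) (L : Layout ρ)
    {n : ℕ → ℕ} {c : ℕ} (hc : 1 ≤ c) {M : ℝ} (m : ℕ) (hcn : ∀ i ≤ m + 1, c ≤ n i)
    (hM : ∀ i j, i ≤ m + 1 → j ≤ m + 1 → i ≠ j → (n i * n j : ℝ) ≤ M)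
    (HA : (l : Fin (m + 1)) → Fin (n l) → Fin (n (l + 1)) → ρ)
    (HS : (l : Fin m) → Fin c → Fin (n (l + 1)) → ρ) :
    ∃ p : Proc ρ (Fin (n 0) → Fin (n (m + 1)) → ρ),
      ∀ (w : World L) A (h : (l : Fin m) → Fin c → Fin (n (l + 1)) → Bool), HoldsChain w HA A →
        (∀ l i j, w.Holds (HS l i j) (sgn (h l i j))) →
        Spec w p (m * ((3 * K + 2) * M * (c : ℝ) ^ (ω - 2)))
          fun H w' => w'.HoldsMat H (sketchedProd A m fun l => tugOfWar (h l)) := by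
  induction m with
  | zero =>
    exact ⟨Proc.ret (HA 0), fun w A h hA _ => (spec_ret (hA 0)).mono (by simp) fun _ _ _ h => h⟩
  | succ m ih =>
    obtain ⟨p, hp⟩ := ih (fun i hi => hcn i (by omega))
      (fun i j hi hj => hM i j (by omega) (by omega)) (fun l => HA l.castSucc)
      (fun l => HS l.castSucc)
    obtain ⟨mul₁, hmul₁⟩ := hK L (n 0) (n (m + 1)) c c hc (hcn _ (by omega)) (hcn _ (by omega)) le_rfl
    obtain ⟨mul₂, hmul₂⟩ := hK L c (n (m + 1)) (n (m + 2)) c hc le_rfl (hcn _ (by omega))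
      (hcn _ (by omega))
    obtain ⟨mul₃, hmul₃⟩ := hK L (n 0) c (n (m + 2)) c hc (hcn _ (by omega)) le_rfl (hcn _ (by omega))
    refine ⟨p.bind fun X => (scaleProc L (HS (Fin.last m))).bind fun S =>
      (mul₁ X fun q r => S r q).bind fun Y => (mul₂ S (HA (Fin.last (m + 1)))).bind fun Z =>
        mul₃ Y Z, fun w A h hA hS => ?_⟩
    refine ((hp w A (fun l => h l.castSucc) (fun l => hA l.castSucc) (fun l => hS l.castSucc)).bind
      fun X w₁ hw₁ hX => (spec_scaleProc w₁ fun i j => (hS (Fin.last m) i j).mono hw₁).bind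
      fun S w₂ hw₂ hS' => ?_).mono_time (T := m * ((3 * K + 2) * M * (c : ℝ) ^ (ω - 2)) +
        (1 + c * n (m + 1) + (K * ((n 0 * n (m + 1) * c / c : ℝ) * (c : ℝ) ^ (ω - 2)) +
          (K * ((c * n (m + 1) * n (m + 2) / c : ℝ) * (c : ℝ) ^ (ω - 2)) +
            K * ((n 0 * c * n (m + 2) / c : ℝ) * (c : ℝ) ^ (ω - 2)))))) ?_
    · have hX₂ := hX.mono hw₂
      refine (hmul₁ w₂ _ (tugOfWar (h (Fin.last m)))ᵀ _ _ hX₂ fun q r => hS' r q).bind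
        fun Y w₃ hw₃ hY => (hmul₂ w₃ _ (A (m + 1)) _ _ (hS'.mono hw₃)
          (hA.mono (hw₁.trans (hw₂.trans hw₃)) (Fin.last (m + 1)))).bind
        fun Z w₄ hw₄ hZ => (hmul₃ w₄ _ _ _ _ (hY.mono hw₄) hZ).mono le_rfl fun H w₅ _ hH => ?_
      rw [← Matrix.mul_assoc] at hH
      exact hH
    · have hc1 : (1 : ℝ) ≤ c := by exact_mod_cast hc
      have hc0 : (c : ℝ) ≠ 0 := by positivity
      set u : ℝ := (c : ℝ) ^ (ω - 2)
      have hu : 1 ≤ u := Real.one_le_rpow hc1 (by linarith)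
      have e1 := hM 0 (m + 1) (by omega) (by omega) (by omega)
      have e2 := hM (m + 1) (m + 2) (by omega) (by omega) (by omega)
      have e3 := hM 0 (m + 2) (by omega) (by omega) (by omega)
      have f1 : (n 0 * n (m + 1) * c / c : ℝ) = n 0 * n (m + 1) := by field_simp
      have f2 : (c * n (m + 1) * n (m + 2) / c : ℝ) = n (m + 1) * n (m + 2) := by field_simp
      have f3 : (n 0 * c * n (m + 2) / c : ℝ) = n 0 * n (m + 2) := by field_simp
      have h0 : (c : ℝ) ≤ n 0 := by exact_mod_cast hcn 0 (by omega)
      have h1 : (c : ℝ) ≤ n (m + 1) := by exact_mod_cast hcn (m + 1) (by omega)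
      have e4 : (c : ℝ) * n (m + 1) ≤ M :=
        (mul_le_mul_of_nonneg_right h0 (Nat.cast_nonneg _)).trans e1
      have e5 : 1 ≤ M := le_trans (by nlinarith) e4
      rw [f1, f2, f3]
      have g : ∀ x : ℝ, x ≤ M → K * (x * u) ≤ K * (M * u) := fun x hx => by gcongr
      have g1 := g _ e1
      have g2 := g _ e2
      have g3 := g _ e3
      have g4 : M ≤ M * u := le_mul_of_one_le_right (by linarith) hu
      push_cast
      linarith

end Chain

/-! ### The product of the squared norms -/

section Norms

variable {ρ : Type}

/-- The product of the squared Frobenius norms of a chain. -/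
noncomputable def normProc (L : Layout ρ) {n : ℕ → ℕ} {m : ℕ}
    (HA : (l : Fin (m + 1)) → Fin (n l) → Fin (n (l + 1)) → ρ) : Proc ρ ρ :=
  (Proc.forAll fun l : Fin (m + 1) =>
    (Proc.forAll fun p : Fin (n l) × Fin (n (l + 1)) =>
      Proc.newArith L .mul (HA l p.1 p.2) (HA l p.1 p.2)).bind fun H => Proc.sum L H).bind
  fun N => Proc.foldFin L .mul 1 (m + 1) N

theorem spec_normProc {L : Layout ρ} (w : World L) {n : ℕ → ℕ} {m : ℕ}
    {HA : (l : Fin (m + 1)) → Fin (n l) → Fin (n (l + 1)) → ρ}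
    {A : (l : ℕ) → Matrix (Fin (n l)) (Fin (n (l + 1))) ℝ} (hA : HoldsChain w HA A) :
    Spec w (normProc L HA) (2 * inputSize n m + 2 * m + 3)
      fun r w' => w'.Holds r (∏ l ∈ Finset.range (m + 1), frobSq (A l)) := by
  refine ((spec_forAll (Q := fun l r w' => w'.Holds r (frobSq (A l)))
    (T := fun l : Fin (m + 1) => 2 * (n l * n (l + 1) : ℝ) + 1)
    (fun p r w' w'' hw h => World.Holds.mono h hw) fun l w₁ hw₁ => ?_).bind
      fun N w₁ hw₁ hN => (spec_foldFin .mul 1 hN).mono le_rfl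
        fun r w' _ hr => ?_).mono_time (le_of_eq ?_)
  · refine ((spec_forAll (Q := fun p r w' => w'.Holds r (A l p.1 p.2 ^ 2)) (T := fun _ => 1)
      (fun p r w' w'' hw h => World.Holds.mono h hw) fun p w₂ hw₂ => ?_).bind
        fun H w₂ hw₂ hH => (spec_sum hH).mono le_rfl fun r w' _ hr => ?_).mono_time (le_of_eq ?_)
    · have := (hA l p.1 p.2).mono (hw₁.trans hw₂)
      rw [sq]
      exact spec_newArith .mul this this
    · rwa [Fintype.sum_prod_type] at hr
    · simp; ring
  · rwa [foldVal_mul, Fin.prod_univ_eq_prod_range (fun l => frobSq (A l))] at hr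
  · rw [Finset.sum_add_distrib, ← Finset.mul_sum,
      Fin.sum_univ_eq_sum_range (fun l => (n l * n (l + 1) : ℝ))]
    simp [inputSize]; ring

end Norms

/-! ### Medians -/

section Median

variable {ρ : Type}

/-- Merge two sorted lists of registers. -/
def mergeProc : List ρ → List ρ → Proc ρ (List ρ)
  | [], l => Proc.ret l
  | a :: l, [] => Proc.ret (a :: l)
  | a :: l, b :: l' => Proc.ifLe a b
      ((mergeProc l (b :: l')).bind fun r => Proc.ret (a :: r))
      ((mergeProc (a :: l) l').bind fun r => Proc.ret (b :: r))
termination_by l l' => l.length + l'.length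

/-- No register is moved, so `w' = w`: the list of register names is permuted by the branch of the
tree that is taken. One comparison settles one position. -/
theorem spec_mergeProc {L : Layout ρ} (w : World L) (v : ρ → ℝ) (l l' : List ρ)
    (hl : ∀ r ∈ l, w.Holds r (v r)) (hl' : ∀ r ∈ l', w.Holds r (v r))
    (hs : l.Pairwise fun x y => v x ≤ v y) (hs' : l'.Pairwise fun x y => v x ≤ v y) :
    Spec w (mergeProc l l') (l.length + l'.length) fun r w' =>
      w' = w ∧ r.Perm (l ++ l') ∧ r.Pairwise fun x y => v x ≤ v y := by
  induction l, l' using mergeProc.induct with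
  | case1 l' =>
    rw [mergeProc]
    refine (spec_ret (Q := fun (r : List ρ) w' => w' = w ∧ r.Perm ([] ++ l') ∧ r.Pairwise fun x y => v x ≤ v y)
      ⟨rfl, by simp, hs'⟩).mono_time (by positivity)
  | case2 a l =>
    rw [mergeProc]
    refine (spec_ret (Q := fun (r : List ρ) w' => w' = w ∧ r.Perm ((a :: l) ++ []) ∧
      r.Pairwise fun x y => v x ≤ v y) ⟨rfl, by simp, hs⟩).mono_time (by positivity)
  | case3 a l b l' ih₁ ih₂ =>
    rw [mergeProc]
    have ha := hl a (by simp)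
    have hb := hl' b (by simp)
    refine (spec_ifLe (T := l.length + l'.length + 1) ha hb (fun hab => ?_) fun hba => ?_).mono_time
      (le_of_eq (by simp; ring))
    · refine (ih₁ (fun r hr => hl r (by simp [hr])) hl' hs.of_cons hs').bind (T' := 0)
        (fun r w' _ ⟨hw, hp, hsr⟩ => spec_ret ⟨hw, ?_, ?_⟩) |>.mono_time (le_of_eq (by simp; ring))
      · exact hp.cons a
      · refine List.pairwise_cons.2 ⟨fun x hx => ?_, hsr⟩
        have hx := hp.mem_iff.1 hx
        rcases List.mem_append.1 hx with hx | hx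
        · exact (List.pairwise_cons.1 hs).1 x hx
        · rcases List.mem_cons.1 hx with rfl | hx
          · exact hab
          · exact hab.trans ((List.pairwise_cons.1 hs').1 x hx)
    · refine (ih₂ hl (fun r hr => hl' r (by simp [hr])) hs hs'.of_cons).bind (T' := 0)
        (fun r w' _ ⟨hw, hp, hsr⟩ => spec_ret ⟨hw, ?_, ?_⟩) |>.mono_time (le_of_eq (by simp; ring))
      · exact (hp.cons b).trans List.perm_middle.symm
      · refine List.pairwise_cons.2 ⟨fun x hx => ?_, hsr⟩
        have hx := hp.mem_iff.1 hx
        rcases List.mem_append.1 hx with hx | hx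
        · rcases List.mem_cons.1 hx with rfl | hx
          · exact hba.le
          · exact hba.le.trans ((List.pairwise_cons.1 hs).1 x hx)
        · exact (List.pairwise_cons.1 hs').1 x hx

/-- Sort a list of at most `2 ^ h` registers. -/
def sortProc : ℕ → List ρ → Proc ρ (List ρ)
  | 0, l => Proc.ret l
  | h + 1, l => (sortProc h (l.take (2 ^ h))).bind fun l₁ =>
      (sortProc h (l.drop (2 ^ h))).bind fun l₂ => mergeProc l₁ l₂

theorem spec_sortProc {L : Layout ρ} (w : World L) (v : ρ → ℝ) (h : ℕ) (l : List ρ)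
    (hl : ∀ r ∈ l, w.Holds r (v r)) (hlen : l.length ≤ 2 ^ h) :
    Spec w (sortProc h l) (h * l.length) fun r w' =>
      w' = w ∧ r.Perm l ∧ r.Pairwise fun x y => v x ≤ v y := by
  induction h generalizing l with
  | zero =>
    refine (spec_ret (Q := fun (r : List ρ) w' => w' = w ∧ r.Perm l ∧ r.Pairwise fun x y => v x ≤ v y)
      ⟨rfl, List.Perm.refl _, ?_⟩).mono_time (by simp)
    match l, hlen with
    | [], _ => simp
    | [a], _ => simp
  | succ h ih =>
    have h1 := ih (l.take (2 ^ h)) (fun r hr => hl r (List.mem_of_mem_take hr)) (by simp)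
    have h2 := ih (l.drop (2 ^ h)) (fun r hr => hl r (List.mem_of_mem_drop hr))
      (by simp only [List.length_drop]; rw [pow_succ] at hlen; omega)
    have hlen' : ((l.take (2 ^ h)).length : ℝ) + (l.drop (2 ^ h)).length = l.length := by
      rw [← Nat.cast_add, ← List.length_append, List.take_append_drop]
    refine (h1.bind (T' := h * (l.drop (2 ^ h)).length + l.length)
      fun l₁ w₁ _ ⟨hw₁, hp₁, hs₁⟩ => ?_).mono_time (le_of_eq ?_)
    · subst hw₁
      refine h2.bind fun l₂ w₂ _ ⟨hw₂, hp₂, hs₂⟩ => ?_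
      subst hw₂
      refine (spec_mergeProc w₂ v l₁ l₂
        (fun r hr => hl r (List.mem_of_mem_take (hp₁.mem_iff.1 hr)))
        (fun r hr => hl r (List.mem_of_mem_drop (hp₂.mem_iff.1 hr))) hs₁ hs₂).mono
          (le_of_eq (by rw [hp₁.length_eq, hp₂.length_eq, hlen'])) fun r w' _ ⟨e1, e2, e3⟩ =>
            ⟨e1, e2.trans ?_, e3⟩
      have := hp₁.append hp₂
      rwa [List.take_append_drop] at this
    · push_cast
      rw [← hlen']; ring

/-- A median of `t` registers. -/
def medianProc (h : ℕ) {t : ℕ} (ht : 1 ≤ t) (H : Fin t → ρ) : Proc ρ ρ :=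
  (sortProc h (List.ofFn H)).bind fun l => Proc.ret (l.getD (t / 2) (H ⟨0, ht⟩))

theorem card_filter_eq_countP {t : ℕ} (H : Fin t → ρ) (p : ρ → Prop) [DecidablePred p] :
    (Finset.univ.filter fun i => p (H i)).card = (List.ofFn H).countP fun r => p r := by
  induction t with
  | zero => simp
  | succ t ih =>
    rw [List.ofFn_succ, List.countP_cons, ← ih, Fin.card_filter_univ_succ]
    by_cases h : p (H 0) <;> simp [h, add_comm]

theorem spec_medianProc {L : Layout ρ} (w : World L) {h t : ℕ} (ht : 1 ≤ t) (hth : t ≤ 2 ^ h)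
    {H : Fin t → ρ} {x : Fin t → ℝ} (hH : ∀ i, w.Holds (H i) (x i)) :
    Spec w (medianProc h ht H) (h * t) fun r w' => ∃ y, w'.Holds r y ∧
      t ≤ 2 * (Finset.univ.filter fun i => x i ≤ y).card ∧
      t ≤ 2 * (Finset.univ.filter fun i => y ≤ x i).card := by
  have hx : ∀ i, x i = w.mem (H i) := fun i => (hH i).mem_eq.symm
  have hmem : ∀ r ∈ List.ofFn H, w.Holds r (w.mem r) := by
    intro r hr
    obtain ⟨i, rfl⟩ := (List.mem_ofFn' H r).1 hr
    rw [← hx]; exact hH i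
  refine ((spec_sortProc w w.mem h (List.ofFn H) hmem (by simpa)).bind (T' := 0)
    fun l w' _ ⟨hw, hp, hs⟩ => spec_ret ?_).mono_time (by simp)
  subst hw
  have hlen : l.length = t := by rw [hp.length_eq]; simp
  have hlt : t / 2 < l.length := by omega
  rw [List.getD_eq_getElem _ _ hlt]
  refine ⟨_, hmem _ (hp.mem_iff.1 (List.getElem_mem hlt)), ?_, ?_⟩
  · simp only [hx]
    rw [card_filter_eq_countP H fun r => w'.mem r ≤ w'.mem l[t / 2], ← hp.countP_eq]
    -- In the sorted list, positions `0, …, t / 2` lie below the median and positions `t / 2, …, t -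
    -- 1` above; both ranges contain at least half of the entries, for either parity of `t`.
    have h1 : (l.take (t / 2 + 1)).countP (fun r => decide (w'.mem r ≤ w'.mem l[t / 2])) =
        (l.take (t / 2 + 1)).length := by
      rw [List.countP_eq_length]
      intro r hr
      obtain ⟨i, hi, rfl⟩ := List.mem_take_iff_getElem.1 hr
      rcases Nat.lt_or_ge i (t / 2) with h | h
      · simpa using List.pairwise_iff_getElem.1 hs i (t / 2) (by omega) hlt h
      · have : i = t / 2 := by omega
        subst this; simp
    have h2 := List.Sublist.countP_le (p := fun r => decide (w'.mem r ≤ w'.mem l[t / 2]))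
      (List.take_sublist (t / 2 + 1) l)
    rw [h1, List.length_take] at h2
    omega
  · simp only [hx]
    rw [card_filter_eq_countP H fun r => w'.mem l[t / 2] ≤ w'.mem r, ← hp.countP_eq]
    have h1 : (l.drop (t / 2)).countP (fun r => decide (w'.mem l[t / 2] ≤ w'.mem r)) =
        (l.drop (t / 2)).length := by
      rw [List.countP_eq_length]
      intro r hr
      obtain ⟨i, hi, rfl⟩ := List.mem_drop_iff_getElem.1 hr
      rcases Nat.eq_zero_or_pos i with rfl | h
      · simp
      · simpa using List.pairwise_iff_getElem.1 hs (t / 2) (t / 2 + i) hlt (by omega) (by omega)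
    have h2 := List.Sublist.countP_le (p := fun r => decide (w'.mem l[t / 2] ≤ w'.mem r))
      (List.drop_sublist (t / 2) l)
    rw [h1, List.length_drop] at h2
    omega

end Median

/-! ### The sketching algorithm -/

/-- If the required probability is zero, the target set is irrelevant; this disposes of the sign
patterns outside the good event. -/
theorem RealProg.Good.weaken {ρ : Type} {p : RealProg ρ} {s : ρ → ℝ} {T : ℝ} {q q' : ENNReal}
    {R R' : Set (ρ → ℝ)} (h : p.Good s T q R) (h' : q' ≠ 0 → q' ≤ q ∧ R ⊆ R') :
    p.Good s T q' R' := by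
  refine ⟨h.time_le, ?_⟩
  by_cases hq : q' = 0
  · simp [hq]
  · obtain ⟨h1, h2⟩ := h' hq
    exact (h1.trans h.le_prob).trans (MeasureTheory.measure_mono h2)

/-- The positions of the signs of `t` independent families of sketches. -/
abbrev SignPos (n : ℕ → ℕ) (m c t : ℕ) : Type :=
  Fin t × ((l : Fin m) × (Fin c × Fin (n (l + 1))))

/-- The signs of `t` families of sketches. -/
def signEquiv (n : ℕ → ℕ) (m c t : ℕ) :
    (SignPos n m c t → Bool) ≃ (Fin t → (l : Fin m) → Fin c → Fin (n (l + 1)) → Bool) where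
  toFun b r l i j := b (r, ⟨l, (i, j)⟩)
  invFun b x := b x.1 x.2.1 x.2.2.1 x.2.2.2
  left_inv _ := rfl
  right_inv _ := rfl

section Main

variable {ρ : Type} {ω K : ℝ}

/-- The memories in which the registers `dst` hold an approximation of the product. -/
def approxSet {n : ℕ → ℕ} {m : ℕ} (dst : Fin (n 0) × Fin (n (m + 1)) → ρ) (ε : ℝ)
    (A : (l : ℕ) → Matrix (Fin (n l)) (Fin (n (l + 1))) ℝ) : Set (ρ → ℝ) :=
  {s | frobNorm ((Matrix.of fun i j => s (dst (i, j))) - chainProd A (m + 1)) ≤ ε}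

/-- All signs of all `t` families are tossed at once. After that the computation is deterministic,
so the probability of success is a count of sign patterns. -/
theorem HasMul.exists_median_sketch (hK : HasMul ω K) (hK0 : 0 ≤ K) (hω : 2 ≤ ω) (L : Layout ρ)
    {n : ℕ → ℕ} {c : ℕ} (hc : 1 ≤ c) {M : ℝ} (m : ℕ) (hcn : ∀ i ≤ m + 1, c ≤ n i)
    (hM : ∀ i j, i ≤ m + 1 → j ≤ m + 1 → i ≠ j → (n i * n j : ℝ) ≤ M)
    (HA : (l : Fin (m + 1)) → Fin (n l) → Fin (n (l + 1)) → ρ)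
    {dst : Fin (n 0) × Fin (n (m + 1)) → ρ} (hinj : Function.Injective dst)
    (hdst : ∀ i, dst i ∈ L.reserved) {t h : ℕ} (ht : 1 ≤ t) (hth : t ≤ 2 ^ h) {ε δ : ℝ}
    (hε : 0 < ε) (hδ : (1 / 2 : ℝ) ^ t ≤ δ) :
    ∃ p : ℕ → RealProg ρ, ∀ (w : World L) A, HoldsChain w HA A →
      576 * 3 ^ (m + 1) * normRatio m A ε ≤ c →
      (p w.next).Good w.mem (t * (m * M) + (t * (m * ((3 * K + 2) * M * (c : ℝ) ^ (ω - 2))) +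
        (M * (h * t) + 2 * M))) (ENNReal.ofReal (1 - δ)) (approxSet dst ε A) := by
  classical
  choose p hp using fun HS => hK.exists_sketchedProd hK0 hω L hc m hcn hM HA HS
  refine ⟨fun f => tossAll L f fun (Hb : SignPos n m c t → ρ) f' =>
    ((Proc.forAll fun r : Fin t => p fun l i j => Hb (r, ⟨l, (i, j)⟩)).bind fun X =>
      Proc.forAll fun q : Fin (n 0) × Fin (n (m + 1)) =>
        medianProc h ht fun r => X r q.1 q.2) f' fun H _ => store dst H, fun w A hA hR => ?_⟩
  set E₀ : Set ((l : Fin m) → Fin c → Fin (n (l + 1)) → Bool) :=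
    {h | frobNorm (sketchedProd A m (fun l => tugOfWar (h l)) - chainProd A (m + 1)) ≤ ε / 3}
  set E₁ : Set (Fin t → (l : Fin m) → Fin c → Fin (n (l + 1)) → Bool) :=
    {x | 3 * {i | x i ∉ E₀}.ncard ≤ t}
  set E : Set (SignPos n m c t → Bool) := {b | signEquiv n m c t b ∈ E₁}
  have hE₀ : 1 - 1 / 64 ≤ prob E₀ := by
    -- The assumed `576` is `3 ^ 2 * 64`: error `ε / 3`, as the median lemma requires, and failure
    -- probability `1 / 64`, as the majority lemma requires.
    refine prob_sketchedProd m n A c (ε / 3) (1 / 64) hc (by positivity) (by norm_num) ?_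
    refine le_trans (le_of_eq ?_) hR
    simp only [normRatio]
    field_simp
    ring
  have hE : 1 - δ ≤ prob E := by
    have h1 : prob E = prob E₁ := avg_equiv (signEquiv n m c t) (E₁.indicator fun _ => (1 : ℝ))
    have h2 : 1 - (1 / 2) ^ t ≤ prob E₁ := prob_majority E₀ hE₀ t
    linarith
  have hcard : (Fintype.card (SignPos n m c t) : ℝ) ≤ t * (m * M) := by
    simp only [Fintype.card_prod, Fintype.card_sigma, Fintype.card_fin]
    push_cast
    refine mul_le_mul_of_nonneg_left ?_ (Nat.cast_nonneg t)
    refine (Finset.sum_le_sum (g := fun _ => M) fun l _ => ?_).trans (by simp)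
    refine le_trans ?_ (hM 0 (l + 1) (by omega) (by omega) (by omega))
    exact mul_le_mul_of_nonneg_right (by exact_mod_cast hcn 0 (by omega)) (Nat.cast_nonneg _)
  have hM0 := hM 0 (m + 1) (by omega) (by omega) (by omega)
  have hgood := good_tossAll w (fun (Hb : SignPos n m c t → ρ) f' =>
    ((Proc.forAll fun r : Fin t => p fun l i j => Hb (r, ⟨l, (i, j)⟩)).bind fun X =>
      Proc.forAll fun q : Fin (n 0) × Fin (n (m + 1)) =>
        medianProc h ht fun r => X r q.1 q.2) f' fun H _ => store dst H) E
    (t * (m * ((3 * K + 2) * M * (c : ℝ) ^ (ω - 2))) +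
        (n 0 * n (m + 1) * (h * t) + 2 * (n 0 * n (m + 1)))) (approxSet dst ε A) ?_
  · refine (hgood.mono ?_).weaken fun _ => ⟨ENNReal.ofReal_le_ofReal hE, subset_rfl⟩
    have : (n 0 * n (m + 1) * (h * t) : ℝ) ≤ M * (h * t) :=
      mul_le_mul_of_nonneg_right hM0 (by positivity)
    linarith
  · intro Hb b w₁ hw₁ hHb
    have hX := spec_forAll (w := w₁)
      (p := fun r : Fin t => p fun l i j => Hb (r, ⟨l, (i, j)⟩))
      (T := fun _ => m * ((3 * K + 2) * M * (c : ℝ) ^ (ω - 2)))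
      (Q := fun r H w' => w'.HoldsMat H
        (sketchedProd A m fun l => tugOfWar (signEquiv n m c t b r l)))
      (fun r H w' w'' hw h => World.HoldsMat.mono h hw)
      fun r w₂ hw₂ => hp _ w₂ A (signEquiv n m c t b r) (hA.mono (hw₁.trans hw₂))
        fun l i j => (hHb _).mono hw₂
    have hmed := hX.bind (g := fun X => Proc.forAll fun q : Fin (n 0) × Fin (n (m + 1)) =>
        medianProc h ht fun r => X r q.1 q.2) (T' := ∑ q : Fin (n 0) × Fin (n (m + 1)), (h * t : ℝ))
      (Q' := fun H w' => ∀ q, ∃ y, w'.Holds (H q) y ∧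
        t ≤ 2 * (Finset.univ.filter fun r => sketchedProd A m
          (fun l => tugOfWar (signEquiv n m c t b r l)) q.1 q.2 ≤ y).card ∧
        t ≤ 2 * (Finset.univ.filter fun r => y ≤ sketchedProd A m
          (fun l => tugOfWar (signEquiv n m c t b r l)) q.1 q.2).card)
      fun X w₂ hw₂ hX => spec_forAll
        (fun q r w' w'' hw ⟨y, h1, h2⟩ => ⟨y, World.Holds.mono h1 hw, h2⟩)
        fun q w₃ hw₃ => spec_medianProc w₃ ht hth fun r => (hX r q.1 q.2).mono hw₃
    refine (hmed _ (2 * (n 0 * n (m + 1))) _ _ fun H w₂ hw₂ hH => ?_).mono (le_of_eq ?_)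
    · choose Y hY hlo hhi using hH
      have hstore := good_store (R := {s | ∀ i, s (dst i) = Y i}) hinj hdst hY fun s hs _ => hs
      refine (hstore.mono (by simp)).weaken fun hq => ?_
      have hb : b ∈ E := by
        by_contra hb
        exact hq (Set.indicator_of_notMem hb _)
      refine ⟨by rw [Set.indicator_of_mem hb], fun s hs => ?_⟩
      have hs' : ∀ i, s (dst i) = Y i := hs
      refine frobNorm_median_sub_le
        (fun r => sketchedProd A m fun l => tugOfWar (signEquiv n m c t b r l)) _ _ hε.le ht hb
        (fun i j => ?_) fun i j => ?_
      · simp only [Matrix.of_apply, hs']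
        exact hlo (i, j)
      · simp only [Matrix.of_apply, hs']
        exact hhi (i, j)
    · simp; ring

/-- Search for a sufficient number `2 ^ i` of rows, and fall back to the exact product. -/
noncomputable def searchProg (L : Layout ρ) (θ : ℝ) (X : ρ) (sk : ℕ → ℕ → RealProg ρ)
    (ex : ℕ → RealProg ρ) : ℕ → ℕ → ℕ → RealProg ρ
  | 0, _ => ex
  | e + 1, i => fun f => Proc.newConst L (2 ^ i / θ) f fun z f' =>
      .branch X z (sk i f') (searchProg L θ X sk ex e (i + 1) f')

/-- The invariant is `2 ^ i ≤ 2 * B`: a failed test means `2 ^ i < θ * x ≤ B`. So the row count that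
is accepted, or the bound `2 ^ N` at the fallback, overshoots by at most a factor `2`. Both tests
and fallback are correct for every input; only the time depends on `x`. -/
theorem good_searchProg {L : Layout ρ} {θ : ℝ} (hθ : 0 < θ) {X : ρ} {sk : ℕ → ℕ → RealProg ρ}
    {ex : ℕ → RealProg ρ} {x B T : ℝ} {N : ℕ} {q : ENNReal} {R : Set (ρ → ℝ)}
    (hB : θ * x ≤ B) {w₀ : World L}
    (hsk : ∀ i < N, (2 : ℝ) ^ i ≤ 2 * B → θ * x ≤ 2 ^ i → ∀ w, w₀ ≤ w →
      (sk i w.next).Good w.mem T q R)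
    (hex : (2 : ℝ) ^ N ≤ 2 * B → ∀ w, w₀ ≤ w → (ex w.next).Good w.mem T q R) (e : ℕ) :
    ∀ (i : ℕ) (w : World L), w₀ ≤ w → w.Holds X x → i + e = N → (2 : ℝ) ^ i ≤ 2 * B →
      (searchProg L θ X sk ex e i w.next).Good w.mem (2 * e + T) q R := by
  induction e with
  | zero =>
    rintro i w hw - rfl hi
    simpa [searchProg] using hex hi w hw
  | succ e ih =>
    intro i w hw hX hN hi
    refine RealProg.Good.mono (T := 1 + (1 + (2 * e + T)))
      (spec_newConst (w := w) (2 ^ i / θ) (fun z f' => .branch X z (sk i f')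
        (searchProg L θ X sk ex e (i + 1) f')) (1 + (2 * e + T)) q R fun z w' hw' hz => ?_) (by push_cast; linarith)
    have hX' := hX.mono hw'
    by_cases h : x ≤ 2 ^ i / θ
    · refine (RealProg.Good.branch_yes (by rwa [hX'.mem_eq, hz.mem_eq]) (hsk i (by omega) hi ?_ w'
        (hw.trans hw'))).mono ?_
      · rwa [mul_comm, ← le_div_iff₀ hθ]
      · have : (0 : ℝ) ≤ e := Nat.cast_nonneg e
        linarith
    · refine RealProg.Good.branch_no (by rwa [hX'.mem_eq, hz.mem_eq]) (ih (i + 1) w'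
        (hw.trans hw') hX' (by omega) ?_)
      rw [not_le, div_lt_iff₀ hθ] at h
      rw [pow_succ]
      linarith

/-- The number of independent repetitions. -/
theorem exists_repetitions {δ : ℝ} (hδ : 0 < δ) :
    ∃ t h : ℕ, 1 ≤ t ∧ t ≤ 2 ^ h ∧ (1 / 2 : ℝ) ^ t ≤ δ ∧
      (t : ℝ) ≤ 3 * max 1 (Real.log (1 / δ)) ∧
      (h : ℝ) ≤ 5 + 2 * Real.log (max 1 (Real.log (1 / δ))) := by
  set ℓ := max 1 (Real.log (1 / δ)) with hℓ
  have h1 : 1 ≤ ℓ := le_max_left _ _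
  -- The factor `2` compensates for `Real.log 2 ≥ 1 / 2` in `(1 / 2) ^ t ≤ δ`.
  set t := ⌈2 * ℓ⌉₊ with ht
  have ht2 : 2 * ℓ ≤ t := Nat.le_ceil _
  have ht3 : (t : ℝ) ≤ 3 * ℓ := by
    have := (Nat.ceil_lt_add_one (by linarith : 0 ≤ 2 * ℓ)).le
    linarith
  have ht1 : 1 ≤ t := by
    have : (1 : ℝ) ≤ t := by linarith
    exact_mod_cast this
  have hlog2 : (1 / 2 : ℝ) ≤ Real.log 2 := by have := Real.log_two_gt_d9; linarith
  refine ⟨t, Nat.clog 2 t, ht1, Nat.le_pow_clog (by norm_num) t, ?_, ht3, ?_⟩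
  · rw [← Real.log_le_log_iff (by positivity) hδ, Real.log_pow, one_div, Real.log_inv]
    have h2 : Real.log (1 / δ) ≤ ℓ := le_max_right _ _
    rw [one_div, Real.log_inv] at h2
    nlinarith
  · have hle : Nat.clog 2 t ≤ Nat.log 2 t + 1 := Nat.clog_le_of_le_pow (Nat.lt_pow_succ_log_self (by norm_num) t).le
    have h3 : (2 : ℝ) ^ Nat.log 2 t ≤ 3 * ℓ := by
      refine le_trans ?_ ht3
      exact_mod_cast Nat.pow_log_le_self 2 (by omega)
    have h4 := Real.log_le_log (by positivity) h3
    rw [Real.log_pow, Real.log_mul (by norm_num) (by linarith)] at h4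
    have h5 : Real.log 3 ≤ 2 := by
      have := Real.log_le_sub_one_of_pos (by norm_num : (0 : ℝ) < 3)
      linarith
    have h6 : (Nat.clog 2 t : ℝ) ≤ Nat.log 2 t + 1 := by exact_mod_cast hle
    have h7 : (Nat.log 2 t : ℝ) * (1 / 2) ≤ Nat.log 2 t * Real.log 2 :=
      mul_le_mul_of_nonneg_left hlog2 (Nat.cast_nonneg _)
    linarith

end Main

/-! ### Dimensions -/

theorem le_maxPair (n : ℕ → ℕ) (m : ℕ) {i j : ℕ} (hi : i ≤ m + 1) (hj : j ≤ m + 1) (hij : i ≠ j) :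
    n i * n j ≤ maxPair n m := by
  refine Finset.le_sup (f := fun p : ℕ × ℕ => n p.1 * n p.2) (b := (i, j)) ?_
  simp only [Finset.mem_offDiag, Finset.mem_range]
  omega

theorem inputSize_le (n : ℕ → ℕ) (m : ℕ) : inputSize n m ≤ (m + 1) * maxPair n m := by
  refine (Finset.sum_le_card_nsmul _ _ (maxPair n m) fun l hl => ?_).trans (by simp)
  have := Finset.mem_range.1 hl
  exact le_maxPair n m (by omega) (by omega) (by omega)

theorem mul_le_inputSize (n : ℕ → ℕ) {m l : ℕ} (hl : l ≤ m) : n l * n (l + 1) ≤ inputSize n m :=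
  Finset.single_le_sum (f := fun l => n l * n (l + 1)) (fun _ _ => Nat.zero_le _)
    (Finset.mem_range.2 (by omega))

theorem exists_min_dim (n : ℕ → ℕ) (m : ℕ) : ∃ j ≤ m + 1, ∀ i ≤ m + 1, n j ≤ n i := by
  obtain ⟨j, hj, h⟩ := Finset.exists_min_image (Finset.range (m + 2)) n ⟨0, by simp⟩
  exact ⟨j, by have := Finset.mem_range.1 hj; omega, fun i hi => h i (Finset.mem_range.2 (by omega))⟩

/-! ### The running time -/

theorem mul_le_mainTime {ω : ℝ} (hω : 2 ≤ ω) (n : ℕ → ℕ) (m : ℕ) (hM : 1 ≤ maxPair n m) (r δ : ℝ) :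
    (3 : ℝ) ^ (((m : ℝ) + 1) * (ω - 2)) ≤ mainTime ω n m r δ ∧
      (maxPair n m : ℝ) ≤ mainTime ω n m r δ ∧
      max 1 (Real.log (1 / δ)) ≤ mainTime ω n m r δ := by
  have h0 : 0 ≤ ω - 2 := by linarith
  have h1 : 1 ≤ (3 : ℝ) ^ (((m : ℝ) + 1) * (ω - 2)) :=
    Real.one_le_rpow (by norm_num) (by positivity)
  have h2 : (1 : ℝ) ≤ maxPair n m := by exact_mod_cast hM
  have h3 : 1 ≤ (max 1 r) ^ (ω - 2) := Real.one_le_rpow (le_max_left _ _) h0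
  have h4 : 1 ≤ max 1 (Real.log (1 / δ)) := le_max_left _ _
  unfold mainTime
  set a := (3 : ℝ) ^ (((m : ℝ) + 1) * (ω - 2))
  set b := (maxPair n m : ℝ)
  set c := (max 1 r) ^ (ω - 2)
  set d := max 1 (Real.log (1 / δ))
  have hab : 1 ≤ a * b := one_le_mul_of_one_le_of_one_le h1 h2
  have habc : 1 ≤ a * b * c := one_le_mul_of_one_le_of_one_le hab h3
  refine ⟨?_, ?_, le_mul_of_one_le_left (by linarith) habc⟩
  · exact (le_mul_of_one_le_right (by linarith) h2).trans
      ((le_mul_of_one_le_right (by linarith) h3).trans (le_mul_of_one_le_right (by linarith) h4))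
  · exact (le_mul_of_one_le_left (by linarith) h1).trans
      ((le_mul_of_one_le_right (by linarith) h3).trans (le_mul_of_one_le_right (by linarith) h4))

theorem sum_times_le {K m t M U h s N : ℝ} (hK : 0 ≤ K) (hm : 0 ≤ m) (ht : 1 ≤ t) (hM : 1 ≤ M)
    (hU : 1 ≤ U) (hh : 0 ≤ h) (hs : s ≤ (m + 1) * M) (hN : N ≤ M) :
    2 * s + 2 * m + 3 + (2 * N + (t * (m * M) + (t * (m * ((3 * K + 2) * M * U)) +
      (M * (h * t) + 2 * M)) + ((K + 2) * s * U + K * (M * U)))) ≤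
    (5 * K + 14) * ((m + 1) * t * M * U * (1 + h)) := by
  -- With all factors at least one, `W` dominates every term without `h`, and `h * W` the sorting
  -- term. The coefficients then add up to `5 * K + 14`.
  set W := (m + 1) * t * M * U with hW
  have hU0 : 0 ≤ U := by linarith
  have hM0 : 0 ≤ M := by linarith
  have ht0 : 0 ≤ t := by linarith
  have hk : 1 ≤ m + 1 := by linarith
  have a1 : (m + 1) * M * U ≤ W := by
    have : (m + 1) * M * U ≤ (m + 1) * M * U * t := le_mul_of_one_le_right (by positivity) ht
    linarith
  have a2 : (m + 1) * M ≤ (m + 1) * M * U := le_mul_of_one_le_right (by positivity) hU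
  have a3 : M ≤ (m + 1) * M := le_mul_of_one_le_left hM0 hk
  have a4 : m + 1 ≤ (m + 1) * M := le_mul_of_one_le_right (by linarith) hM
  have a5 : M * U ≤ (m + 1) * M * U := mul_le_mul_of_nonneg_right a3 hU0
  have a6 : (m + 1) * t * M ≤ W := le_mul_of_one_le_right (by positivity) hU
  have a7 : t * M ≤ (m + 1) * t * M := by
    have : t * M ≤ (m + 1) * (t * M) := le_mul_of_one_le_left (by positivity) hk
    linarith
  have a8 : s * U ≤ W := (mul_le_mul_of_nonneg_right hs hU0).trans a1
  have a9 : t * (m * M) ≤ W := by nlinarith [mul_nonneg ht0 hM0]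
  have a10 : t * (m * (M * U)) ≤ W := by
    have : 0 ≤ t * (M * U) := by positivity
    have : W = t * (m * (M * U)) + t * (M * U) := by rw [hW]; ring
    linarith
  have a11 : h * (t * M) ≤ h * W := mul_le_mul_of_nonneg_left (by linarith) hh
  have a12 := mul_le_mul_of_nonneg_left a10 (by positivity : 0 ≤ 3 * K + 2)
  have a13 := mul_le_mul_of_nonneg_left a8 (by positivity : 0 ≤ K + 2)
  have a14 := mul_le_mul_of_nonneg_left (a5.trans a1) hK
  have hW0 : 0 ≤ W := by positivity
  have a15 : 0 ≤ K * (h * W) := by positivity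
  have a16 : 0 ≤ h * W := by positivity
  nlinarith

theorem rows_rpow_le {ω : ℝ} (hω : 2 ≤ ω) (m : ℕ) (r : ℝ) :
    (2 * max 1 (576 * 3 ^ (m + 1) * r)) ^ (ω - 2) ≤
      (1152 : ℝ) ^ (ω - 2) * ((3 : ℝ) ^ (((m : ℝ) + 1) * (ω - 2)) * (max 1 r) ^ (ω - 2)) := by
  have h3 : (1 : ℝ) ≤ 3 ^ (m + 1) := one_le_pow₀ (by norm_num)
  have hr : 1 ≤ max 1 r := le_max_left _ _
  have h1 : 2 * max 1 (576 * 3 ^ (m + 1) * r) ≤ 1152 * (3 ^ (m + 1) * max 1 r) := by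
    have : max 1 (576 * 3 ^ (m + 1) * r) ≤ 576 * (3 ^ (m + 1) * max 1 r) := by
      refine max_le ?_ ?_
      · nlinarith
      · rw [← mul_assoc]
        exact mul_le_mul_of_nonneg_left (le_max_right _ _) (by positivity)
    linarith
  refine (Real.rpow_le_rpow (by positivity) h1 (by linarith)).trans (le_of_eq ?_)
  rw [Real.mul_rpow (by norm_num) (by positivity), Real.mul_rpow (by positivity) (by positivity),
    Real.rpow_mul (by norm_num)]
  norm_cast

theorem time_le_softly {ω K : ℝ} (hω : 2 < ω) (hK : 0 ≤ K) (n : ℕ → ℕ) (m : ℕ)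
    (hM : 1 ≤ maxPair n m) (r δ : ℝ) {t h : ℝ} (ht0 : 0 ≤ t) (hh0 : 0 ≤ h)
    (ht : t ≤ 3 * max 1 (Real.log (1 / δ)))
    (hh : h ≤ 5 + 2 * Real.log (max 1 (Real.log (1 / δ)))) :
    (5 * K + 14) * ((m + 1) * t * maxPair n m *
        (2 * max 1 (576 * 3 ^ (m + 1) * r)) ^ (ω - 2) * (1 + h)) ≤
      (5 * K + 14) * 18 * (1152 : ℝ) ^ (ω - 2) / (ω - 2) * mainTime ω n m r δ *
        (1 + Real.log (mainTime ω n m r δ)) ^ 2 := by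
  obtain ⟨g1, g2, g3⟩ := mul_le_mainTime hω.le n m hM r δ
  have hω' : 0 < ω - 2 := by linarith
  set g := mainTime ω n m r δ with hg
  set ℓ := max 1 (Real.log (1 / δ)) with hℓ
  have hℓ1 : 1 ≤ ℓ := le_max_left _ _
  have hg1 : 1 ≤ g := hℓ1.trans g3
  have hlog : 0 ≤ Real.log g := Real.log_nonneg hg1
  -- Here the number of matrices becomes a logarithmic factor, since `g` is at least `3 ^ ((m + 1) *
  -- (ω - 2))`. The division by `ω - 2` is what excludes `ω = 2`. The other logarithm comes from
  -- sorting, and `18 = 3 * 6` from the bounds on `t` and `1 + h`.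
  have hk : (m : ℝ) + 1 ≤ (1 + Real.log g) / (ω - 2) := by
    rw [le_div_iff₀ hω']
    have h1 := Real.log_le_log (by positivity) g1
    rw [Real.log_rpow (by norm_num)] at h1
    have h2 : 1 ≤ Real.log 3 := by
      rw [Real.le_log_iff_exp_le (by norm_num)]
      have := Real.exp_one_lt_d9
      linarith
    have h3 : ((m : ℝ) + 1) * (ω - 2) ≤ ((m : ℝ) + 1) * (ω - 2) * Real.log 3 :=
      le_mul_of_one_le_right (by positivity) h2
    linarith
  have hh' : 1 + h ≤ 6 * (1 + Real.log g) := by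
    have := Real.log_le_log (by linarith) g3
    linarith
  have hU := rows_rpow_le hω.le m r
  set U := (2 * max 1 (576 * 3 ^ (m + 1) * r)) ^ (ω - 2)
  have hU0 : 0 ≤ U := by positivity
  calc (5 * K + 14) * ((m + 1) * t * maxPair n m * U * (1 + h))
      ≤ (5 * K + 14) * ((1 + Real.log g) / (ω - 2) * (3 * ℓ) * maxPair n m *
          ((1152 : ℝ) ^ (ω - 2) * ((3 : ℝ) ^ (((m : ℝ) + 1) * (ω - 2)) * (max 1 r) ^ (ω - 2))) *
          (6 * (1 + Real.log g))) := by gcongr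
    _ = _ := by rw [hg, mainTime]; ring

/-! ### The programs -/

theorem HasMul.exists_sketching_program {ρ : Type} {ω K : ℝ} (hK : HasMul ω K) (hK0 : 0 ≤ K)
    (hω : 2 < ω) (L : Layout ρ) {n : ℕ → ℕ} {m : ℕ} (hn : ∀ i ≤ m + 1, 1 ≤ n i)
    (HA : (l : Fin (m + 1)) → Fin (n l) → Fin (n (l + 1)) → ρ)
    {dst : Fin (n 0) × Fin (n (m + 1)) → ρ} (hinj : Function.Injective dst)
    (hdst : ∀ i, dst i ∈ L.reserved) {ε δ : ℝ} (hε : 0 < ε) (hδ : 0 < δ) :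
    ∃ p : ℕ → RealProg ρ, ∀ (w : World L) A, HoldsChain w HA A →
      (p w.next).Good w.mem ((5 * K + 14) * 18 * (1152 : ℝ) ^ (ω - 2) / (ω - 2) *
          mainTime ω n m (normRatio m A ε) δ *
          (1 + Real.log (mainTime ω n m (normRatio m A ε) δ)) ^ 2)
        (ENNReal.ofReal (1 - δ)) (approxSet dst ε A) := by
  obtain ⟨j, hj, hmin⟩ := exists_min_dim n m
  obtain ⟨t, h, ht1, hth, htδ, ht3, hh⟩ := exists_repetitions hδ
  have hpos := hn j hj
  obtain ⟨ex, hex⟩ := hK.exists_chainProd hω.le L HA hj hmin hpos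
  obtain ⟨M, hMdef⟩ : ∃ M : ℝ, M = maxPair n m := ⟨_, rfl⟩
  have hpair : ∀ i j, i ≤ m + 1 → j ≤ m + 1 → i ≠ j → (n i * n j : ℝ) ≤ M := fun i j hi hj hij => by
    rw [hMdef]
    exact_mod_cast le_maxPair n m hi hj hij
  -- For `i < N` the count `2 ^ i` does not exceed the smallest dimension, as the sketched product
  -- demands; `2 ^ N` does.
  set N := Nat.log 2 (n j) + 1 with hN
  have hsk : ∀ i : ℕ, ∃ p : ℕ → RealProg ρ, i < N → ∀ (w : World L) A, HoldsChain w HA A →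
      576 * 3 ^ (m + 1) * normRatio m A ε ≤ ((2 ^ i : ℕ) : ℝ) →
      (p w.next).Good w.mem (t * (m * M) + (t * (m * ((3 * K + 2) * M * ((2 ^ i : ℕ) : ℝ) ^ (ω - 2))) +
        (M * (h * t) + 2 * M))) (ENNReal.ofReal (1 - δ)) (approxSet dst ε A) := by
    intro i
    by_cases hi : i < N
    · have hc : 2 ^ i ≤ n j :=
        (Nat.pow_le_pow_right (by norm_num) (by omega)).trans (Nat.pow_log_le_self 2 (by omega))
      obtain ⟨p, hp⟩ := hK.exists_median_sketch hK0 hω.le L Nat.one_le_two_pow m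
        (fun i hi => hc.trans (hmin i hi)) hpair HA hinj hdst ht1 hth hε htδ
      exact ⟨p, fun _ => hp⟩
    -- A dummy for row counts that the search never reaches.
    · exact ⟨fun _ => .halt, fun h => absurd h hi⟩
  choose sk hsk using hsk
  -- Known when the program is built, so the search compares the computed product of squared norms
  -- with the constants `2 ^ i / θ`.
  set θ : ℝ := 576 * 3 ^ (m + 1) / ε ^ 2 with hθ
  have hθ0 : 0 < θ := by positivity
  refine ⟨fun f => normProc L HA f fun X => searchProg L θ X sk
    (fun f => ex f fun H _ => store dst fun q => H q.1 q.2) N 0, fun w A hA => ?_⟩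
  set r := normRatio m A ε with hr
  set B := max 1 (576 * 3 ^ (m + 1) * r) with hB
  set U : ℝ := (2 * B) ^ (ω - 2) with hU
  have hB1 : 1 ≤ B := le_max_left _ _
  have hω0 : 0 ≤ ω - 2 := by linarith
  have hU1 : 1 ≤ U := Real.one_le_rpow (by linarith) hω0
  have hmn : 1 ≤ maxPair n m := le_trans (Nat.mul_pos (hn 0 (by omega)) (hn (m + 1) le_rfl))
    (le_maxPair n m (by omega) le_rfl (by omega))
  have hM1 : 1 ≤ M := by rw [hMdef]; exact_mod_cast hmn
  have hM01 := hpair 0 (m + 1) (by omega) le_rfl (by omega)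
  have hθr : θ * ∏ l ∈ Finset.range (m + 1), frobSq (A l) = 576 * 3 ^ (m + 1) * r := by
    rw [hr, normRatio, hθ]
    simp only [frobNorm_sq]
    ring
  set T := t * (m * M) + (t * (m * ((3 * K + 2) * M * U)) + (M * (h * t) + 2 * M)) +
    ((K + 2) * inputSize n m * U + K * (M * U)) with hT
  have hgood := spec_normProc w hA (fun X => searchProg L θ X sk
    (fun f => ex f fun H _ => store dst fun q => H q.1 q.2) N 0) (2 * N + T)
    (ENNReal.ofReal (1 - δ)) (approxSet dst ε A) fun X w₁ hw₁ hX =>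
      good_searchProg hθ0 (N := N) (B := B) (hθr.trans_le (le_max_right _ _)) (w₀ := w₁) ?_ ?_ N 0 w₁
        le_rfl hX (by omega) (by simp; linarith)
  · have htime := time_le_softly hω hK0 n m hmn r δ (Nat.cast_nonneg t) (Nat.cast_nonneg h) ht3 hh
    rw [← hMdef] at htime
    refine hgood.mono (le_trans ?_ htime)
    refine sum_times_le hK0 (Nat.cast_nonneg m) (by exact_mod_cast ht1) hM1 hU1
      (Nat.cast_nonneg h) (by rw [hMdef]; exact_mod_cast inputSize_le n m) ?_
    have h1 : N ≤ n j := Nat.log_lt_self 2 (by omega)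
    have h2 : n j ≤ maxPair n m := by
      rcases Nat.eq_zero_or_pos j with h0 | h0
      · exact (Nat.le_mul_of_pos_right _ (hn (m + 1) le_rfl)).trans
          (le_maxPair n m hj le_rfl (by omega))
      · exact (Nat.le_mul_of_pos_right _ (hn 0 (by omega))).trans
          (le_maxPair n m hj (by omega) (by omega))
    rw [hMdef]
    exact_mod_cast h1.trans h2
  · intro i hi hiB hri w₂ hw₂
    refine (hsk i hi w₂ A (hA.mono (hw₁.trans hw₂)) ?_).mono ?_
    · rw [← hr, ← hθr]
      exact_mod_cast hri
    · have hle : ((2 ^ i : ℕ) : ℝ) ^ (ω - 2) ≤ U :=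
        Real.rpow_le_rpow (Nat.cast_nonneg _) (by exact_mod_cast hiB) hω0
      have h1 : (t * (m * ((3 * K + 2) * M * ((2 ^ i : ℕ) : ℝ) ^ (ω - 2))) : ℝ) ≤
        t * (m * ((3 * K + 2) * M * U)) := by gcongr
      have h2 : 0 ≤ (K + 2) * inputSize n m * U + K * (M * U) := by positivity
      linarith
  · intro hNB w₂ hw₂
    have hspec := hex w₂ A (hA.mono (hw₁.trans hw₂)) (fun H _ => store dst fun q => H q.1 q.2)
      (2 * (n 0 * n (m + 1))) 1 (approxSet dst ε A) fun H w₃ hw₃ hH =>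
        (good_store hinj hdst (fun q => hH q.1 q.2) fun s hs _ => by
          show frobNorm _ ≤ ε
          have : (Matrix.of fun i j => s (dst (i, j))) = chainProd A (m + 1) := by
            ext i j; exact hs (i, j)
          rw [this, sub_self, frobNorm_eq_sqrt]
          simpa using hε.le).mono (by simp)
    refine (hspec.mono ?_).weaken fun _ =>
      ⟨by rw [ENNReal.ofReal_le_one]; linarith, subset_rfl⟩
    -- The fallback is reached only if `n j < 2 ^ N ≤ 2 * B`, so exact multiplication at the
    -- smallest dimension is within the budget of the sketch.
    have hle : (n j : ℝ) ^ (ω - 2) ≤ U := by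
      refine Real.rpow_le_rpow (Nat.cast_nonneg _) (le_trans ?_ hNB) hω0
      exact_mod_cast (Nat.lt_pow_succ_log_self (by norm_num) (n j)).le
    have h1 : (K + 2) * inputSize n m * (n j : ℝ) ^ (ω - 2) ≤ (K + 2) * inputSize n m * U := by
      gcongr
    have h2 : K * (n 0 * n (m + 1) * (n j : ℝ) ^ (ω - 2)) ≤ K * (M * U) := by gcongr
    have h3 : (0 : ℝ) ≤ t * (m * M) + t * (m * ((3 * K + 2) * M * U)) + M * (h * t) := by
      positivity
    linarith

/-! ### Register labels, and exact programs for `ω = 2` -/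

/-- Work registers `tmp` with the label `b`. -/
def workLayout (ι κ : Type) (b : ℕ) (S : Set (Reg ι κ))
    (hS : ∀ x, Reg.tmp (Nat.pair b x) ∉ S) : Layout (Reg ι κ) where
  cell g i := .tmp (Nat.pair b (Nat.pair g i))
  cell_inj h := by
    have := Reg.tmp.inj h
    simpa [Nat.pair_eq_pair] using this
  reserved := S
  cell_not_mem _ _ := hS _

/-- The input registers of a chain. -/
def chainRegs (n : ℕ → ℕ) (m : ℕ) (l : Fin (m + 1)) (i : Fin (n l)) (j : Fin (n (l + 1))) :
    ChainReg n m :=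
  .inp ⟨l, (i, j)⟩

/-- The world at the start of the computation. -/
def startWorld {n : ℕ → ℕ} {m : ℕ} (b : ℕ) (S : Set (ChainReg n m))
    (hS : ∀ x, Reg.tmp (Nat.pair b x) ∉ S)
    (A : (l : ℕ) → Matrix (Fin (n l)) (Fin (n (l + 1))) ℝ) : World (workLayout _ _ b S hS) where
  next := 0
  mem := chainInput m A
  fresh _ _ _ := rfl

theorem holdsChain_startWorld {n : ℕ → ℕ} {m : ℕ} {b : ℕ} {S : Set (ChainReg n m)}
    (hS : ∀ x, Reg.tmp (Nat.pair b x) ∉ S) (hS' : ∀ i, Reg.inp i ∉ S)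
    (A : (l : ℕ) → Matrix (Fin (n l)) (Fin (n (l + 1))) ℝ) :
    HoldsChain (startWorld b S hS A) (chainRegs n m) A :=
  fun _ _ _ => ⟨hS' _, fun _ _ _ h => Reg.noConfusion rfl rfl (heq_of_eq h), rfl⟩

theorem RealProg.Good.support_subset {ρ : Type} {p : RealProg ρ} {s : ρ → ℝ} {T : ℝ}
    {R : Set (ρ → ℝ)} (h : p.Good s T 1 R) : ∀ s' ∈ (p.run s).support, s' ∈ R :=
  (PMF.toOuterMeasure_apply_eq_one_iff _ _).1
    (le_antisymm ((MeasureTheory.measure_mono (Set.subset_univ R)).trans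
      (by rw [(PMF.toOuterMeasure_apply_eq_one_iff _ _).2 (Set.subset_univ _)])) h.le_prob)

/-- With `d ^ (ω - 2) = 1` the factors cost a multiple of the input size, and their product a
multiple of `n 0 * n (m + 1)`. The latter is at most `maxPair n m`, with no factor for the length of
the chain. Label `0` is the work space of the preprocessing, `1` that of the main program, and `2`
holds the factors that are handed over. -/
theorem HasMul.exists_exact_programs {K : ℝ} (hK : HasMul 2 K) (hK0 : 0 ≤ K) (m : ℕ) (n : ℕ → ℕ)
    (hn : ∀ i ≤ m + 1, 1 ≤ n i) :
    ∃ pre main : RealProg (ChainReg n m), ∀ A : (l : ℕ) → Matrix (Fin (n l)) (Fin (n (l + 1))) ℝ,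
      (pre.time (chainInput m A) : ℝ) ≤ (K + 6) * inputSize n m ∧
      ∀ s ∈ (pre.run (chainInput m A)).support,
        (main.time s : ℝ) ≤ (K + 6) * maxPair n m ∧
        ∀ s' ∈ (main.run s).support, outMatrix s' = chainProd A (m + 1) := by
  obtain ⟨j, hj, hmin⟩ := exists_min_dim n m
  have hpos := hn j hj
  set S : Set (ChainReg n m) := {r | ∃ x, r = .tmp (Nat.pair 2 x)}
  have hS : ∀ b, b ≠ 2 → ∀ x, (Reg.tmp (Nat.pair b x) : ChainReg n m) ∉ S := by
    rintro b hb x ⟨y, hy⟩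
    have := Reg.tmp.inj hy
    rw [Nat.pair_eq_pair] at this
    exact hb this.1
  set S' : Set (ChainReg n m) := Set.range .out
  have hS' : ∀ t, (Reg.tmp t : ChainReg n m) ∉ S' := by
    rintro t ⟨y, hy⟩
    cases hy
  obtain ⟨p, hp⟩ := hK.exists_factors le_rfl (workLayout _ _ 0 S (hS 0 (by norm_num)))
    (chainRegs n m) hj hmin hpos
  obtain ⟨mul, hmul⟩ := hK (workLayout _ _ 1 S' fun _ => hS' _) (n 0) (n j) (n (m + 1)) (n j) hpos
    (hmin 0 (by omega)) le_rfl (hmin _ le_rfl)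
  set ι := (Fin (n 0) × Fin (n j)) ⊕ (Fin (n j) × Fin (n (m + 1)))
  set dst : ι → ChainReg n m := fun x => .tmp (Nat.pair 2 (Fintype.equivFin ι x)) with hdst
  have hinj : Function.Injective dst := by
    intro x y h
    have := Reg.tmp.inj h
    rw [Nat.pair_eq_pair] at this
    exact (Fintype.equivFin ι).injective (Fin.ext this.2)
  refine ⟨p 0 fun H _ => store dst (Sum.elim (fun q => H.1 q.1 q.2) fun q => H.2 q.1 q.2),
    mul (fun i j => dst (.inl (i, j))) (fun i j => dst (.inr (i, j))) 0 fun H _ =>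
      store (fun q => Reg.out q) fun q => H q.1 q.2, fun A => ?_⟩
  have hA := holdsChain_startWorld (hS 0 (by norm_num)) (by rintro i ⟨x, hx⟩; cases hx) A
  set Rpre : Set (ChainReg n m → ℝ) :=
    {s | (∀ x, s (.tmp (Nat.pair 1 x)) = 0) ∧
      ∃ (U : Matrix (Fin (n 0)) (Fin (n j)) ℝ) (V : Matrix (Fin (n j)) (Fin (n (m + 1))) ℝ),
        (∀ x y, s (dst (.inl (x, y))) = U x y) ∧ (∀ x y, s (dst (.inr (x, y))) = V x y) ∧
        U * V = chainProd A (m + 1)}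
  have hpre := hp _ A hA
    (fun H _ => store dst (Sum.elim (fun q => H.1 q.1 q.2) fun q => H.2 q.1 q.2))
    (2 * (n 0 * n j + n j * n (m + 1))) 1
    Rpre ?_
  · refine ⟨hpre.time_le.trans ?_, fun s hs => ?_⟩
    · have h1 : n 0 * n j ≤ inputSize n m :=
        (Nat.mul_le_mul_left _ (hmin 1 (by omega))).trans (mul_le_inputSize n (Nat.zero_le m))
      have h2 : n j * n (m + 1) ≤ inputSize n m :=
        (Nat.mul_le_mul_right _ (hmin m (by omega))).trans (mul_le_inputSize n le_rfl)
      have h1' : (n 0 * n j : ℝ) ≤ inputSize n m := by exact_mod_cast h1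
      have h2' : (n j * n (m + 1) : ℝ) ≤ inputSize n m := by exact_mod_cast h2
      simp only [sub_self, Real.rpow_zero, mul_one]
      linarith
    · obtain ⟨h0, U, V, hU, hV, hUV⟩ := hpre.support_subset s hs
      -- The memory left by the preprocessing, seen with the work space of label `1`, which is still
      -- zero. The factors under label `2` now count as registers in use.
      let w : World (workLayout (ChainPos n m) (Fin (n 0) × Fin (n (m + 1))) 1 S' fun _ => hS' _) :=
        ⟨0, s, fun g _ i => h0 _⟩
      have hold : ∀ x g i, dst x ≠ (workLayout (ChainPos n m) (Fin (n 0) × Fin (n (m + 1))) 1 S'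
          fun _ => hS' _).cell g i := by
        intro x g i h
        have := Reg.tmp.inj h
        rw [Nat.pair_eq_pair] at this
        omega
      have hmain := hmul w U V _ _ (fun x y => ⟨hS' _, fun g _ i => hold _ g i, hU x y⟩)
        (fun x y => ⟨hS' _, fun g _ i => hold _ g i, hV x y⟩)
        (fun H _ => store (fun q => Reg.out q) fun q => H q.1 q.2) (2 * (n 0 * n (m + 1))) 1
        {s' | outMatrix s' = chainProd A (m + 1)} fun H w' hw' hH =>
          (good_store (fun _ _ => Reg.out.inj) (fun i => (Set.mem_range_self i : _ ∈ S')) (fun q => hH q.1 q.2)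
            fun s hs _ => by
              show outMatrix s = _
              rw [← hUV]
              ext x y
              exact hs (x, y)).mono (by simp)
      refine ⟨hmain.time_le.trans ?_, hmain.support_subset⟩
      have h1 : (n 0 * n (m + 1) : ℝ) ≤ maxPair n m := by
        exact_mod_cast le_maxPair n m (by omega) le_rfl (by omega : (0 : ℕ) ≠ m + 1)
      have h2 : (n 0 * n j * n (m + 1) / n j : ℝ) = n 0 * n (m + 1) := by
        have : (n j : ℝ) ≠ 0 := by positivity
        field_simp
      rw [h2]
      simp only [sub_self, Real.rpow_zero, mul_one]
      have h3 := mul_le_mul_of_nonneg_left h1 (by linarith : 0 ≤ K + 2)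
      have h4 : (0 : ℝ) ≤ maxPair n m := Nat.cast_nonneg _
      linarith
  · intro H w' hw' ⟨U, V, hU, hV, hUV⟩
    have hdstS : ∀ x, dst x ∈ S := fun x => ⟨_, rfl⟩
    refine (good_store (R := Rpre) (v := Sum.elim (fun q : Fin (n 0) × Fin (n j) => U q.1 q.2)
      fun q : Fin (n j) × Fin (n (m + 1)) => V q.1 q.2) hinj
      hdstS (by rintro (q | q) <;> [exact hU _ _; exact hV _ _])
      fun s hs hs' => ⟨fun x => ?_, U, V, fun x y => hs (.inl (x, y)), fun x y => hs (.inr (x, y)),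
        hUV⟩).mono (by simp)
    rw [hs' _ (hS 1 (by norm_num) x), hw'.2]
    · rfl
    · intro g _ i h
      have := Reg.tmp.inj h
      rw [Nat.pair_eq_pair] at this
      omega

/-! ### The theorem -/

theorem softBound_of_le {C C' : ℝ} (hC' : 0 ≤ C') (hCC : C' ≤ C) {p T : ℕ} {g g' : ℝ} (hg : 1 ≤ g)
    (hg' : g' ≤ g) (hT : (T : ℝ) ≤ C' * g') : SoftBound C p T g := by
  have h1 : 1 ≤ (1 + Real.log g) ^ p := one_le_pow₀ (by have := Real.log_nonneg hg; linarith)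
  have h2 : C' * g' ≤ C * g := by
    refine (mul_le_mul_of_nonneg_left hg' hC').trans ?_
    exact mul_le_mul_of_nonneg_right hCC (by linarith)
  exact (hT.trans h2).trans (le_mul_of_one_le_right (mul_nonneg (hC'.trans hCC) (by linarith)) h1)

theorem theorem4p7 (ω : ℝ) (hω : 2 ≤ ω) (hmul : IsMatMulExponent ω) :
    -- the sketched product, for uniformly random signs
    (∀ (m : ℕ) (n : ℕ → ℕ) (A : (l : ℕ) → Matrix (Fin (n l)) (Fin (n (l + 1))) ℝ)
        (c : ℕ) (ε δ : ℝ), 1 ≤ c → 0 < ε → 0 < δ →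
        3 ^ (m + 1) * normRatio m A ε / δ ≤ (c : ℝ) →
        ENNReal.ofReal (1 - δ) ≤
          (PMF.uniformOfFintype ((l : Fin m) → Fin c → Fin (n (l + 1)) → Bool)).toOuterMeasure
            {h | frobNorm (sketchedProd A m (fun l => tugOfWar (h l)) - chainProd A (m + 1)) ≤ ε}) ∧
    -- the algorithm: a preprocessing program followed by the main program
    (∃ (C : ℝ) (p : ℕ), ∀ (m : ℕ) (n : ℕ → ℕ), (∀ i ≤ m + 1, 1 ≤ n i) →
      ∀ ε δ : ℝ, 0 < ε → 0 < δ → δ < 1 →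
        ∃ pre main : RealProg (ChainReg n m),
          ∀ A : (l : ℕ) → Matrix (Fin (n l)) (Fin (n (l + 1))) ℝ,
            SoftBound C p (pre.time (chainInput m A)) (inputSize n m) ∧
            (∀ s ∈ (pre.run (chainInput m A)).support,
              SoftBound C p (main.time s) (mainTime ω n m (normRatio m A ε) δ)) ∧
            ENNReal.ofReal (1 - δ) ≤
              ((pre.run (chainInput m A)).bind main.run).toOuterMeasure
                {s | frobNorm (outMatrix s - chainProd A (m + 1)) ≤ ε}) := by
  refine ⟨fun m n A c ε δ hc hε hδ hR => ?_, ?_⟩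
  · rw [toOuterMeasure_uniform]
    exact ENNReal.ofReal_le_ofReal (prob_sketchedProd m n A c ε δ hc hε hδ hR)
  obtain ⟨K, hK1, hK⟩ := exists_hasMul hω hmul
  have hK0 : 0 ≤ K := by linarith
  rcases hω.eq_or_lt with rfl | hω'
  -- For `ω = 2` the product is exact and no logarithmic factor is needed.
  · refine ⟨K + 6, 0, fun m n hn ε δ hε hδ _ => ?_⟩
    obtain ⟨pre, main, h⟩ := hK.exists_exact_programs hK0 m n hn
    have hs : 1 ≤ inputSize n m :=
      le_trans (Nat.mul_pos (hn 0 (by omega)) (hn 1 (by omega))) (mul_le_inputSize n (Nat.zero_le m))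
    have hM : 1 ≤ maxPair n m := le_trans (Nat.mul_pos (hn 0 (by omega)) (hn (m + 1) le_rfl))
      (le_maxPair n m (by omega) le_rfl (by omega))
    refine ⟨pre, main, fun A => ⟨?_, fun s hs => ?_, ?_⟩⟩
    · exact softBound_of_le (by linarith) le_rfl (by exact_mod_cast hs) le_rfl (h A).1
    · obtain ⟨-, hg, hg'⟩ := mul_le_mainTime le_rfl n m hM (normRatio m A ε) δ
      exact softBound_of_le (by linarith) le_rfl ((le_max_left _ _).trans hg') hg ((h A).2 s hs).1
    · refine RealProg.le_toOuterMeasure_bind _ _ _ _ fun s hs => ?_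
      have h1 : ((main.run s).toOuterMeasure
          {s | frobNorm (outMatrix s - chainProd A (m + 1)) ≤ ε}) = 1 := by
        rw [PMF.toOuterMeasure_apply_eq_one_iff]
        intro s' hs'
        show frobNorm _ ≤ ε
        rw [((h A).2 s hs).2 s' hs', sub_self, frobNorm_eq_sqrt]
        simpa using hε.le
      rw [h1, ENNReal.ofReal_le_one]
      linarith
  · refine ⟨(5 * K + 14) * 18 * (1152 : ℝ) ^ (ω - 2) / (ω - 2), 2, fun m n hn ε δ hε hδ _ => ?_⟩
    set S' : Set (ChainReg n m) := Set.range .out with hS'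
    have hS : ∀ x, (Reg.tmp (Nat.pair 0 x) : ChainReg n m) ∉ S' := by
      rintro x ⟨y, hy⟩
      cases hy
    obtain ⟨p, hp⟩ := hK.exists_sketching_program hK0 hω' (workLayout _ _ 0 S' hS) hn
      (chainRegs n m) (dst := Reg.out) (fun _ _ => Reg.out.inj)
      (fun i => (Set.mem_range_self i : _ ∈ S')) hε hδ
    -- For `ω > 2` no preprocessing is needed: reading the input costs at most `(m + 1) * maxPair n
    -- m`, which the main bound absorbs.
    refine ⟨.halt, p 0, fun A => ?_⟩
    have h := hp _ A (holdsChain_startWorld hS (by rintro i ⟨y, hy⟩; cases hy) A)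
    refine ⟨?_, fun s hs => ?_, ?_⟩
    · have h1 : 0 ≤ 1 + Real.log (inputSize n m) := by
        have := Real.log_natCast_nonneg (inputSize n m)
        linarith
      have h2 : 0 < ω - 2 := by linarith
      simp only [SoftBound, RealProg.time, Nat.cast_zero]
      positivity
    · have hs' : s = chainInput m A := by simpa [RealProg.run] using hs
      rw [hs']
      exact h.time_le
    · rw [RealProg.run, PMF.pure_bind]
      exact h.le_prob
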